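/- Let $(\mathcal U,\mathbb P_u)$ be a Polish probability space and $K:\mathcal U\times\mathcal U\to\mathbb R$ a measurable positive semi-definite kernel with $\int K(u,u)\,\mathbb P_u(du)<\infty$. Let $\mathbb K=\sum_{j\ge 1}\xi_j\psi_j\psi_j^*$ be the spectral decomposition of the integral operator $\mathbb Kf(u)=\int K(u,u')f(u')\,\mathbb P_u(du')$ on $L^2(\mathcal U,\mathbb P_u)$, where $\xi_1\ge\xi_2\ge\cdots>0$ are its positive eigenvalues (finitely or infinitely many; if there are finitely many, set the later $\xi_j$ equal to $0$) and $(\psi_j)$ are orthonormal eigenfunctions. For an integer $m\ge 0$ put $$K_{>m}(u,u')=\sum_{j>m}\xi_j\psi_j(u)\psi_j(u'),\qquad \mathrm{Tr}(\mathbb K_{>m})=\mathrm{Tr}(\Sigma_{>m})=\sum_{j>m}\xi_j .$$ Let $n\ge 1$, $n\neq 2$, let $u_1,\dots,u_n$ be i.i.d. with law $\mathbb P_u$, let $\boldsymbol K_{>m}=(K_{>m}(u_i,u_j))_{i,j\in[n]}$, and suppose that $n\,\xi_{m+1}\le \mathrm{Tr}(\Sigma_{>m})$. Assume: (a) there are an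 integer $\bar e>m$, not larger than the number of positive eigenvalues, with $n\,\xi_{\bar e+1}\le\xi_{m+1}$, and constants $\bar\beta,\bar C>0$, such that $\|h\|_{L^q}^2\le(\bar Cq)^{\bar\beta}\|h\|_{L^2}^2$ for every $h\in\mathrm{span}\{\psi_j: m<j\le\bar e\}$ and every integer $q\ge2$; (b) there is $\alpha_1>0$ such that, with $u\sim\mathbb P_u$, $$\mathbb E\Big[\max_{i\in[n]}\big|K_{>m}(u_i,u_i)-\mathbb E[K_{>m}(u,u)]\big|\Big]\le\alpha_1\sqrt{\frac{n\xi_{m+1}}{\mathrm{Tr}(\mathbb K_{>m})}}\cdot\mathbb E[K_{>m}(u,u)].$$ Then $$\mathbb E\Big[\big\|\boldsymbol K_{>m}-\mathrm{Tr}(\mathbb K_{>m})\,\mathbf I_n\big\|_{\rm op}\Big]\le C\Big\{\alpha_1+(2\bar C)^{\bar\beta}\log^{\bar\beta}(n)\Big\}\sqrt{\frac{n\xi_{m+1}}{\mathrm{Tr}(\Sigma_{>m})}}\cdot\mathrm{Tr}(\Sigma_{>m}),$$ where $C>0$ is a universal constant (the expectation on the left being finite). -/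

import Mathlib

open MeasureTheory ProbabilityTheory

universe u v

noncomputable section

/-- A positive semi-definite kernel: a symmetric function all of whose finite Gram matrices are
positive semi-definite. -/
structure IsPSDKernel {U : Type u} (K : U → U → ℝ) : Prop where
  symm : ∀ x y, K x y = K y x
  nonneg : ∀ (k : ℕ) (x : Fin k → U) (c : Fin k → ℝ),
    0 ≤ ∑ i, ∑ j, c i * c j * K (x i) (x j)

/-- The integral operator `𝕂 f (x) = ∫ K(x, y) f(y) P(dy)`. -/
def kernelOp {U : Type u} [MeasurableSpace U] (P : Measure U) (K : U → U → ℝ) (f : U → ℝ) :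
    U → ℝ :=
  fun x => ∫ y, K x y * f y ∂P

/-- The spectral decomposition `𝕂 = ∑_j ξ_j ψ_j ψ_j^*` of the integral operator of `K` on
`L²(U, P)`.  The number `r` of positive eigenvalues may be finite or infinite. Indices start at `0`:
`ξ j` and `ψ j` are the eigenvalue and eigenfunction number `j + 1`.  When `r` is finite, `ξ` is
extended by zero, and `ψ j` carries no information for `r ≤ j`. -/
structure IsSpectralDecomposition {U : Type u} [MeasurableSpace U] (P : Measure U)
    (K : U → U → ℝ) (r : ℕ∞) (ξ : ℕ → ℝ) (ψ : ℕ → U → ℝ) : Prop where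
  pos : ∀ j : ℕ, (j : ℕ∞) < r → 0 < ξ j
  zero : ∀ j : ℕ, r ≤ (j : ℕ∞) → ξ j = 0
  antitone : Antitone ξ
  measurable : ∀ j : ℕ, (j : ℕ∞) < r → Measurable (ψ j)
  memLp : ∀ j : ℕ, (j : ℕ∞) < r → MemLp (ψ j) 2 P
  orthonormal : ∀ i j : ℕ, (i : ℕ∞) < r → (j : ℕ∞) < r →
    ∫ x, ψ i x * ψ j x ∂P = if i = j then 1 else 0
  eigen : ∀ j : ℕ, (j : ℕ∞) < r → kernelOp P K (ψ j) =ᵐ[P] fun x => ξ j * ψ j x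
  /-- `𝕂` vanishes on the orthogonal complement of the eigenfunctions. -/
  complete : ∀ f : U → ℝ, MemLp f 2 P →
    (∀ j : ℕ, (j : ℕ∞) < r → ∫ x, f x * ψ j x ∂P = 0) → kernelOp P K f =ᵐ[P] 0

/-- The high-degree part of the kernel, `K_{>m}(x, y) = ∑_{j > m} ξ_j ψ_j(x) ψ_j(y)`. -/
def highKernel {U : Type u} (ξ : ℕ → ℝ) (ψ : ℕ → U → ℝ) (m : ℕ) (x y : U) : ℝ :=
  ∑' j : ℕ, ξ (m + j) * ψ (m + j) x * ψ (m + j) y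

/-- `Tr(𝕂_{>m}) = Tr(Σ_{>m}) = ∑_{j > m} ξ_j`. -/
def highTrace (ξ : ℕ → ℝ) (m : ℕ) : ℝ :=
  ∑' j : ℕ, ξ (m + j)

/-- The empirical matrix `(K_{>m}(x_i, x_j))_{i,j}`. -/
def highMatrix {U : Type u} (ξ : ℕ → ℝ) (ψ : ℕ → U → ℝ) (m : ℕ) {n : ℕ} (x : Fin n → U) :
    Matrix (Fin n) (Fin n) ℝ :=
  Matrix.of fun i j => highKernel ξ ψ m (x i) (x j)

/-- The operator norm of a matrix for the Euclidean norm. -/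
def matrixOpNorm {n : ℕ} (A : Matrix (Fin n) (Fin n) ℝ) : ℝ :=
  ‖Matrix.toEuclideanCLM (n := Fin n) (𝕜 := ℝ) A‖

/-- Hypercontractivity of `span {ψ_{m+1}, …, ψ_e}`: `‖h‖_{L^q}² ≤ (C q)^β ‖h‖_{L²}²` for every `h`
in the span and every integer `q ≥ 2`. -/
def HypercontractiveSpan {U : Type u} [MeasurableSpace U] (P : Measure U) (ψ : ℕ → U → ℝ)
    (m e : ℕ) (C β : ℝ) : Prop :=
  ∀ h ∈ Submodule.span ℝ (ψ '' Set.Ico m e), ∀ q : ℕ, 2 ≤ q →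
    eLpNorm h (q : ENNReal) P ^ 2 ≤ ENNReal.ofReal ((C * q) ^ β) * eLpNorm h 2 P ^ 2

/-- The maximal fluctuation of the diagonal of `K_{>m}` over the sample `X 0, …, X (n - 1)` is
bounded in expectation by `α₁ √(n ξ_{m+1} / Tr(𝕂_{>m})) · E[K_{>m}(u, u)]`. -/
def DiagonalConcentration {U : Type u} [MeasurableSpace U] (P : Measure U)
    {Ω : Type v} [MeasurableSpace Ω] (μ : Measure Ω) (ξ : ℕ → ℝ) (ψ : ℕ → U → ℝ) (m : ℕ)
    {n : ℕ} (X : Fin n → Ω → U) (α₁ : ℝ) : Prop :=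
  ∫ ω, (⨆ i : Fin n, |highKernel ξ ψ m (X i ω) (X i ω) - ∫ x, highKernel ξ ψ m x x ∂P|) ∂μ
    ≤ α₁ * √(n * ξ m / highTrace ξ m) * ∫ x, highKernel ξ ψ m x x ∂P

end

/-!
For `n = 1` only the diagonal is present, so let `n ≥ 3`. Write `φ_l = √ξ_{m+l} ψ_{m+l}`, let
`d = e - m` be the number of hypercontractive directions, `T` the trace, `τ = √(n ξ_m T)` and
`s = ⌊log n⌋`. Hypercontractivity at the even order `2 s ≤ 2 log n` has the constant
`A = (2 Cbar) ^ β (log n) ^ β ≥ 1`. The matrix `K - T • 1` is the sum of its diagonal, the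
off-diagonal part of the Gram matrix of `φ_0, …, φ_{d-1}`, and the off-diagonal part of the tail.
The diagonal is controlled by assumption. The expected squared Frobenius norm of the tail is at
most `n² ∑_{l ≥ d} ξ_{m+l}² ≤ n² ξ_e T ≤ τ²`. It remains to bound the expected norm `D` of the
off-diagonal part of the leading block by a multiple of `(α₁ + A) τ`.

Decoupling (`matrixOpNorm_offDiagonal_le_decoupled`) reduces this to blocks with rows in a set `T`
of indices and columns outside it. With the points outside `T` fixed, the rows of a block are
i.i.d. vectors `Y`, with `E ⟨v, Y⟩² ≤ ξ_m ‖G‖ ‖v‖²` for the full Gram matrix `G`, and with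
`E ‖Y‖ ^ (2 s) ≤ (A ξ_m (Tr G + T)) ^ s` by hypercontractivity. For such matrices a bound of
matrix Chernoff type holds without any matrix exponential: if `‖Y‖² ≤ R`, then in
`Tr (∑ Y_j Y_jᵀ) ^ p` one factor `Y_j Y_jᵀ` is split off, and `rank_one_perturbation_pow_le`
removes `Y_j` from the remaining power at the price of a shift by `R`, so that independence
applies. This gives `lintegral_trace_gramSum_pow_le`, by induction on `p`. Truncation at a level
`R` of the order of the moment bound gives `lintegral_rows_matrixOpNorm_sq_le`. Since `‖G‖` is at
most its largest diagonal entry plus the norm of its off-diagonal part, the outcome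
`D ≲ √(n ξ_m (T + α₁ τ + D)) + √(s A) τ` is self-bounding, and yields `D ≲ (1 + α₁ + √(s A)) τ`.

The remaining logarithm `s` is absorbed by a lower bound on `A`: hypercontractivity forces
`4 A ≥ min s d` (`dimension_le_of_moment_bound`, by counting symmetric tensors). If `4 A ≥ s`,
then `√(s A) ≤ 2 A`. Otherwise `d ≤ 4 A`, and the Frobenius norm of the leading block, of order
`n ξ_m √d ≤ τ √d`, is small enough.
-/

open Matrix Finset

/-! ### Positive semi-definite matrices and rank-one perturbations -/

theorem Matrix.PosSemidef.exists_orthogonal_diagonalization {ι : Type*} [Fintype ι] [DecidableEq ι]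
    {X : Matrix ι ι ℝ} (hX : X.PosSemidef) :
    ∃ (V : Matrix ι ι ℝ) (l : ι → ℝ), Vᵀ * V = 1 ∧ V * Vᵀ = 1 ∧ (∀ a, 0 ≤ l a) ∧
      X = V * diagonal l * Vᵀ := by
  have h := hX.isHermitian.spectral_theorem
  refine ⟨hX.isHermitian.eigenvectorUnitary, hX.isHermitian.eigenvalues, ?_, ?_,
    hX.eigenvalues_nonneg, ?_⟩
  · have := Unitary.coe_star_mul_self hX.isHermitian.eigenvectorUnitary
    simpa [star_eq_conjTranspose] using this
  · have := Unitary.coe_mul_star_self hX.isHermitian.eigenvectorUnitary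
    simpa [star_eq_conjTranspose] using this
  · conv_lhs => rw [h]
    rw [Unitary.conjStarAlgAut_apply]
    simp [star_eq_conjTranspose]

theorem orthogonal_conj_pow {ι : Type*} [Fintype ι] [DecidableEq ι] {V : Matrix ι ι ℝ}
    (hV : Vᵀ * V = 1) (hV' : V * Vᵀ = 1) (M : Matrix ι ι ℝ) (k : ℕ) :
    (V * M * Vᵀ) ^ k = V * M ^ k * Vᵀ := by
  induction k with
  | zero => simp [hV']
  | succ k ih =>
    rw [pow_succ, ih, pow_succ]
    calc V * M ^ k * Vᵀ * (V * M * Vᵀ) = V * M ^ k * (Vᵀ * V) * M * Vᵀ := by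
          simp only [Matrix.mul_assoc]
      _ = _ := by rw [hV]; simp only [Matrix.mul_assoc, Matrix.mul_one]

theorem dotProduct_conj_mulVec {ι : Type*} [Fintype ι] (V M : Matrix ι ι ℝ) (y : ι → ℝ) :
    y ⬝ᵥ (V * M * Vᵀ) *ᵥ y = (Vᵀ *ᵥ y) ⬝ᵥ M *ᵥ (Vᵀ *ᵥ y) := by
  rw [← mulVec_mulVec, ← mulVec_mulVec, dotProduct_mulVec, ← mulVec_transpose]

/-- Chebyshev's sum inequality with weights `w`. -/
theorem chebyshev_weighted {ι : Type*} [Fintype ι] {w f g : ι → ℝ} (hw : ∀ a, 0 ≤ w a)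
    (hfg : Monovary f g) :
    (∑ a, f a * w a) * (∑ a, g a * w a) ≤ (∑ a, w a) * ∑ a, f a * g a * w a := by
  have h : 0 ≤ ∑ a, ∑ b, w a * w b * ((f a - f b) * (g a - g b)) :=
    sum_nonneg fun a _ => sum_nonneg fun b _ =>
      mul_nonneg (mul_nonneg (hw a) (hw b)) (monovary_iff_forall_mul_nonneg.1 hfg b a)
  have e : ∑ a, ∑ b, w a * w b * ((f a - f b) * (g a - g b)) =
      2 * ((∑ a, w a) * ∑ a, f a * g a * w a) - 2 * ((∑ a, f a * w a) * (∑ a, g a * w a)) := by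
    have e1 : ∀ a b, w a * w b * ((f a - f b) * (g a - g b)) =
        w b * (f a * g a * w a) + w a * (f b * g b * w b)
          - (g b * w b * (f a * w a) + f b * w b * (g a * w a)) := fun a b => by ring
    simp only [e1, sum_sub_distrib, sum_add_distrib, ← sum_mul, ← mul_sum]
    ring
  linarith

/-- The diagonal case of `rank_one_perturbation_pow_le`, with an additional weight `f` that is a
monotone function of the diagonal entries.  The weight makes the induction on `k` close. -/
theorem rank_one_perturbation_diagonal {ι : Type*} [Fintype ι] [DecidableEq ι] {l c : ι → ℝ} {R : ℝ}
    (hl : ∀ a, 0 ≤ l a) (hc : ∑ a, c a ^ 2 ≤ R) (k : ℕ) :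
    ∀ f : ι → ℝ, (∀ a, 0 ≤ f a) → (∀ a b, l a ≤ l b → f a ≤ f b) →
      ∑ a, f a * (c a * (((diagonal l + vecMulVec c c) ^ k) *ᵥ c) a)
        ≤ ∑ a, f a * (l a + R) ^ k * c a ^ 2 := by
  have hR : 0 ≤ R := (sum_nonneg fun a _ => sq_nonneg _).trans hc
  induction k with
  | zero => intro f _ _; simp [pow_two]
  | succ k ih =>
    intro f hf hmono
    set w := ((diagonal l + vecMulVec c c) ^ k) *ᵥ c with hw
    have hstep : ∀ a, ((diagonal l + vecMulVec c c) ^ (k + 1) *ᵥ c) a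
        = l a * w a + (∑ b, c b * w b) * c a := by
      intro a
      rw [pow_succ', ← mulVec_mulVec, ← hw, add_mulVec, vecMulVec_mulVec]
      simp [mulVec_diagonal, dotProduct, mul_comm]
    have h1 := ih (fun a => f a * l a) (fun a => mul_nonneg (hf a) (hl a)) (fun a b h =>
      mul_le_mul (hmono a b h) h (hl a) (hf b))
    have h2 := ih (fun _ => 1) (fun _ => zero_le_one) (fun _ _ _ => le_rfl)
    simp only [one_mul] at h2
    have h3 : (∑ a, f a * c a ^ 2) * (∑ a, (l a + R) ^ k * c a ^ 2)
        ≤ (∑ a, c a ^ 2) * ∑ a, f a * (l a + R) ^ k * c a ^ 2 := by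
      refine chebyshev_weighted (fun a => sq_nonneg _) ?_
      intro a b hab
      refine hmono a b ?_
      by_contra hcon
      push Not at hcon
      exact absurd hab (not_lt.2 (pow_le_pow_left₀ (add_nonneg (hl b) hR) (by linarith) k))
    have hnn : 0 ≤ ∑ a, f a * (l a + R) ^ k * c a ^ 2 := sum_nonneg fun a _ =>
      mul_nonneg (mul_nonneg (hf a) (pow_nonneg (add_nonneg (hl a) hR) k)) (sq_nonneg _)
    have hfc : 0 ≤ ∑ a, f a * c a ^ 2 := sum_nonneg fun a _ => mul_nonneg (hf a) (sq_nonneg _)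
    calc ∑ a, f a * (c a * ((diagonal l + vecMulVec c c) ^ (k + 1) *ᵥ c) a)
        = ∑ a, f a * l a * (c a * w a) + (∑ a, f a * c a ^ 2) * ∑ b, c b * w b := by
          rw [sum_mul, ← sum_add_distrib]
          refine sum_congr rfl fun a _ => ?_
          rw [hstep]; ring
      _ ≤ ∑ a, f a * l a * (l a + R) ^ k * c a ^ 2
            + R * ∑ a, f a * (l a + R) ^ k * c a ^ 2 := by
          refine add_le_add h1 ((mul_le_mul_of_nonneg_left h2 hfc).trans (h3.trans ?_))
          exact mul_le_mul_of_nonneg_right hc hnn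
      _ = _ := by
          rw [mul_sum, ← sum_add_distrib]
          refine sum_congr rfl fun a _ => ?_
          ring

theorem dotProduct_self_mulVec_orthogonal {ι : Type*} [Fintype ι] [DecidableEq ι]
    {V : Matrix ι ι ℝ} (hV' : V * Vᵀ = 1) (y : ι → ℝ) :
    ∑ a, (Vᵀ *ᵥ y) a ^ 2 = ∑ a, y a ^ 2 := by
  have := dotProduct_conj_mulVec V 1 y
  simp only [Matrix.mul_one, hV', one_mulVec] at this
  simpa [dotProduct, pow_two] using this.symm

/-- In the quadratic form at `y`, perturbing `X` by the rank-one matrix `y yᵀ` costs at most as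
much as the shift by `R ≥ ‖y‖²`, for every power, although powers are not operator monotone. -/
theorem rank_one_perturbation_pow_le {ι : Type*} [Fintype ι] [DecidableEq ι] {X : Matrix ι ι ℝ}
    (hX : X.PosSemidef) {y : ι → ℝ} {R : ℝ} (hy : ∑ a, y a ^ 2 ≤ R) (k : ℕ) :
    y ⬝ᵥ ((X + vecMulVec y y) ^ k) *ᵥ y ≤ y ⬝ᵥ ((X + R • (1 : Matrix ι ι ℝ)) ^ k) *ᵥ y := by
  obtain ⟨V, l, hV, hV', hl, rfl⟩ := hX.exists_orthogonal_diagonalization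
  set c := Vᵀ *ᵥ y with hc
  have hyc : y = V *ᵥ c := by rw [hc, mulVec_mulVec, hV', one_mulVec]
  have h1 : V * diagonal l * Vᵀ + vecMulVec y y = V * (diagonal l + vecMulVec c c) * Vᵀ := by
    rw [Matrix.mul_add, Matrix.add_mul, mul_vecMulVec, vecMulVec_mul, vecMul_transpose, ← hyc]
  have h2 : V * diagonal l * Vᵀ + R • (1 : Matrix ι ι ℝ)
      = V * diagonal (fun a => l a + R) * Vᵀ := by
    have : diagonal (fun a => l a + R) = diagonal l + R • (1 : Matrix ι ι ℝ) := by
      rw [smul_one_eq_diagonal, diagonal_add]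
    rw [this, Matrix.mul_add, Matrix.add_mul]
    simp [hV']
  rw [h1, h2, orthogonal_conj_pow hV hV', orthogonal_conj_pow hV hV', dotProduct_conj_mulVec,
    dotProduct_conj_mulVec, ← hc]
  have hcR : ∑ a, c a ^ 2 ≤ R := by rw [hc, dotProduct_self_mulVec_orthogonal hV']; exact hy
  have := rank_one_perturbation_diagonal hl hcR k (fun _ => 1) (fun _ => zero_le_one)
    (fun _ _ _ => le_rfl)
  simp only [one_mul] at this
  refine this.trans (le_of_eq ?_)
  simp only [diagonal_pow, mulVec_diagonal, dotProduct, Pi.pow_apply]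
  exact sum_congr rfl fun a _ => by ring

/-- A substitute for `‖S‖ ≤ (Tr S ^ p) ^ (1 / p)` without roots. -/
theorem quadratic_form_le_trace_pow {ι : Type*} [Fintype ι] [DecidableEq ι] {S : Matrix ι ι ℝ}
    (hS : S.PosSemidef) {b : ℝ} (hb : 0 < b) (q : ℕ) (v : ι → ℝ) :
    v ⬝ᵥ S *ᵥ v ≤ (b + (S ^ (q + 1)).trace / b ^ q) * ∑ a, v a ^ 2 := by
  obtain ⟨V, l, hV, hV', hl, rfl⟩ := hS.exists_orthogonal_diagonalization
  rw [orthogonal_conj_pow hV hV', trace_mul_comm, ← Matrix.mul_assoc, hV, Matrix.one_mul,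
    dotProduct_conj_mulVec, ← dotProduct_self_mulVec_orthogonal hV' v]
  simp only [diagonal_pow, mulVec_diagonal, dotProduct, trace_diagonal, mul_sum, Pi.pow_apply]
  refine sum_le_sum fun a _ => ?_
  have h1 : l a ≤ b + l a ^ (q + 1) / b ^ q := by
    rcases le_or_gt (l a) b with h | h
    · have : 0 ≤ l a ^ (q + 1) / b ^ q := by have := hl a; positivity
      linarith
    · have : l a ≤ l a ^ (q + 1) / b ^ q := by
        rw [le_div_iff₀ (by positivity), pow_succ']
        exact mul_le_mul_of_nonneg_left (pow_le_pow_left₀ hb.le h.le q) (hl a)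
      linarith
  have h2 : l a ^ (q + 1) ≤ ∑ a, l a ^ (q + 1) :=
    single_le_sum (f := fun a => l a ^ (q + 1)) (fun a _ => pow_nonneg (hl a) _) (mem_univ a)
  have h3 : l a ≤ b + (∑ a, l a ^ (q + 1)) / b ^ q :=
    h1.trans (add_le_add le_rfl (div_le_div_of_nonneg_right h2 (by positivity)))
  have := mul_le_mul_of_nonneg_right h3 (sq_nonneg ((Vᵀ *ᵥ v) a))
  calc _ = l a * (Vᵀ *ᵥ v) a ^ 2 := by ring
    _ ≤ _ := this

/-- The Gram sum `∑_{j ∈ J} y_j y_jᵀ`. -/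
def gramSum {N ι : Type*} (J : Finset N) (y : N → ι → ℝ) : Matrix ι ι ℝ :=
  ∑ j ∈ J, vecMulVec (y j) (y j)

theorem gramSum_posSemidef {N ι : Type*} [Fintype ι] (J : Finset N) (y : N → ι → ℝ) :
    (gramSum J y).PosSemidef :=
  posSemidef_sum J fun j _ => by simpa using posSemidef_vecMulVec_self_star (y j)

theorem gramSum_add_smul_one_posSemidef {N ι : Type*} [Fintype ι] [DecidableEq ι] (J : Finset N)
    (y : N → ι → ℝ) {c : ℝ} (hc : 0 ≤ c) :
    (gramSum J y + c • (1 : Matrix ι ι ℝ)).PosSemidef :=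
  (gramSum_posSemidef J y).add (PosSemidef.one.smul hc)

/-- One step of the trace recursion: a factor `S + c` is split off the power, and in each of the
resulting quadratic forms the vector `y j` is removed from the remaining power, which is then
independent of it. -/
theorem trace_gramSum_pow_succ_le {N ι : Type*} [DecidableEq N] [Fintype ι] [DecidableEq ι]
    (J : Finset N) (y : N → ι → ℝ) {c R : ℝ} (hc : 0 ≤ c)
    (hy : ∀ j ∈ J, ∑ a, y j a ^ 2 ≤ R) (p : ℕ) :
    ((gramSum J y + c • (1 : Matrix ι ι ℝ)) ^ (p + 1)).trace ≤
      ∑ j ∈ J, y j ⬝ᵥ ((gramSum (J.erase j) y + (c + R) • (1 : Matrix ι ι ℝ)) ^ p) *ᵥ y j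
        + c * ((gramSum J y + c • (1 : Matrix ι ι ℝ)) ^ p).trace := by
  set W := gramSum J y + c • (1 : Matrix ι ι ℝ) with hW
  have e : W ^ (p + 1) = ∑ j ∈ J, vecMulVec (y j) (y j) * W ^ p + c • W ^ p := by
    rw [pow_succ']
    nth_rw 1 [hW]
    rw [Matrix.add_mul, gramSum, Matrix.sum_mul, smul_mul, Matrix.one_mul]
  rw [e, trace_add, trace_sum, trace_smul, smul_eq_mul]
  refine add_le_add (sum_le_sum fun j hj => ?_) le_rfl
  rw [vecMulVec_mul, trace_vecMulVec, dotProduct_comm, ← dotProduct_mulVec]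
  have h1 : W = (gramSum (J.erase j) y + c • (1 : Matrix ι ι ℝ)) + vecMulVec (y j) (y j) := by
    rw [hW, gramSum, gramSum, ← sum_erase_add _ _ hj]
    abel
  have h2 : gramSum (J.erase j) y + (c + R) • (1 : Matrix ι ι ℝ)
      = (gramSum (J.erase j) y + c • (1 : Matrix ι ι ℝ)) + R • (1 : Matrix ι ι ℝ) := by
    rw [add_smul, add_assoc]
  rw [h1, h2]
  exact rank_one_perturbation_pow_le (gramSum_add_smul_one_posSemidef _ _ hc) (hy j hj) p

/-! ### The operator norm of a matrix -/

theorem matrixOpNorm_nonneg {n : ℕ} (A : Matrix (Fin n) (Fin n) ℝ) : 0 ≤ matrixOpNorm A :=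
  norm_nonneg _

theorem sum_mulVec_sq_le {n : ℕ} (A : Matrix (Fin n) (Fin n) ℝ) (v : Fin n → ℝ) :
    ∑ i, (A *ᵥ v) i ^ 2 ≤ matrixOpNorm A ^ 2 * ∑ i, v i ^ 2 := by
  have h := (toEuclideanCLM (n := Fin n) (𝕜 := ℝ) A).le_opNorm (WithLp.toLp 2 v)
  have h2 := pow_le_pow_left₀ (norm_nonneg _) h 2
  rw [mul_pow, EuclideanSpace.norm_sq_eq, EuclideanSpace.norm_sq_eq] at h2
  simpa [matrixOpNorm] using h2

theorem matrixOpNorm_le_of_sq {n : ℕ} {A : Matrix (Fin n) (Fin n) ℝ} {c : ℝ} (hc : 0 ≤ c)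
    (h : ∀ v : Fin n → ℝ, ∑ i, (A *ᵥ v) i ^ 2 ≤ c ^ 2 * ∑ i, v i ^ 2) : matrixOpNorm A ≤ c := by
  refine ContinuousLinearMap.opNorm_le_bound _ hc fun x => ?_
  refine le_of_sq_le_sq ?_ (by positivity)
  rw [mul_pow, EuclideanSpace.norm_sq_eq, EuclideanSpace.norm_sq_eq]
  simpa using h x.ofLp

theorem matrixOpNorm_sq_le {n : ℕ} {A : Matrix (Fin n) (Fin n) ℝ} {c : ℝ} (hc : 0 ≤ c)
    (h : ∀ v : Fin n → ℝ, ∑ i, (A *ᵥ v) i ^ 2 ≤ c * ∑ i, v i ^ 2) : matrixOpNorm A ^ 2 ≤ c := by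
  have : matrixOpNorm A ≤ √c :=
    matrixOpNorm_le_of_sq (Real.sqrt_nonneg c) fun v => by rw [Real.sq_sqrt hc]; exact h v
  calc _ ≤ √c ^ 2 := pow_le_pow_left₀ (matrixOpNorm_nonneg A) this 2
    _ = c := Real.sq_sqrt hc

theorem matrixOpNorm_add_le {n : ℕ} (A B : Matrix (Fin n) (Fin n) ℝ) :
    matrixOpNorm (A + B) ≤ matrixOpNorm A + matrixOpNorm B := by
  unfold matrixOpNorm
  rw [map_add]
  exact norm_add_le _ _

theorem matrixOpNorm_smul {n : ℕ} (c : ℝ) (A : Matrix (Fin n) (Fin n) ℝ) :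
    matrixOpNorm (c • A) = |c| * matrixOpNorm A := by
  unfold matrixOpNorm
  rw [map_smul, norm_smul, Real.norm_eq_abs]

theorem matrixOpNorm_sum_le {n : ℕ} {κ : Type*} (s : Finset κ)
    (A : κ → Matrix (Fin n) (Fin n) ℝ) :
    matrixOpNorm (∑ k ∈ s, A k) ≤ ∑ k ∈ s, matrixOpNorm (A k) := by
  unfold matrixOpNorm
  rw [map_sum]
  exact norm_sum_le _ _

theorem matrixOpNorm_sq_le_frobenius {n : ℕ} (A : Matrix (Fin n) (Fin n) ℝ) :
    matrixOpNorm A ^ 2 ≤ ∑ i, ∑ j, A i j ^ 2 := by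
  refine matrixOpNorm_sq_le (sum_nonneg fun i _ => sum_nonneg fun j _ => sq_nonneg _) fun v => ?_
  rw [sum_mul]
  exact sum_le_sum fun i _ => sum_mul_sq_le_sq_mul_sq univ (A i) v

theorem matrixOpNorm_diagonal_le {n : ℕ} {d : Fin n → ℝ} {c : ℝ} (hc : 0 ≤ c)
    (h : ∀ i, |d i| ≤ c) : matrixOpNorm (diagonal d) ≤ c := by
  refine matrixOpNorm_le_of_sq hc fun v => ?_
  rw [mul_sum]
  refine sum_le_sum fun i _ => ?_
  rw [mulVec_diagonal, mul_pow]
  exact mul_le_mul_of_nonneg_right (sq_le_sq.2 (by rw [abs_of_nonneg hc]; exact h i)) (sq_nonneg _)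

theorem dotProduct_mulVec_le_matrixOpNorm {n : ℕ} (A : Matrix (Fin n) (Fin n) ℝ) (v : Fin n → ℝ) :
    v ⬝ᵥ A *ᵥ v ≤ matrixOpNorm A * ∑ i, v i ^ 2 := by
  have h1 := sum_mulVec_sq_le A v
  have h0 : 0 ≤ ∑ i, v i ^ 2 := sum_nonneg fun i _ => sq_nonneg _
  have h2 : (v ⬝ᵥ A *ᵥ v) ^ 2 ≤ (∑ i, v i ^ 2) * ∑ i, (A *ᵥ v) i ^ 2 :=
    sum_mul_sq_le_sq_mul_sq _ _ _
  refine le_of_sq_le_sq ?_ (mul_nonneg (matrixOpNorm_nonneg A) h0)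
  nlinarith [mul_le_mul_of_nonneg_left h1 h0]

theorem continuous_matrixOpNorm {n : ℕ} :
    Continuous (matrixOpNorm : Matrix (Fin n) (Fin n) ℝ → ℝ) := by
  unfold matrixOpNorm
  exact continuous_norm.comp (LinearMap.continuous_of_finiteDimensional
    (toEuclideanCLM (n := Fin n) (𝕜 := ℝ)).toAlgEquiv.toLinearMap)

/-! ### Trace moments of sums of independent rank-one matrices -/

/-- Resampling the coordinates in `T` does not change the law of an i.i.d. sample. -/
theorem lintegral_pi_eq_lintegral_piecewise {U : Type*} [MeasurableSpace U] {P : Measure U}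
    [IsProbabilityMeasure P] {N : Type*} [Fintype N] [DecidableEq N] (T : Finset N)
    {f : (N → U) → ENNReal} (hf : Measurable f) :
    ∫⁻ x, f x ∂Measure.pi (fun _ : N => P) =
      ∫⁻ x, ∫⁻ y, f (T.piecewise y x) ∂Measure.pi (fun _ : N => P)
        ∂Measure.pi (fun _ : N => P) := by
  set π := Measure.pi (fun _ : N => P) with hπ
  have hm : Measurable fun z : (N → U) × (N → U) => T.piecewise z.2 z.1 := by
    refine measurable_pi_lambda _ fun i => ?_
    by_cases hi : i ∈ T
    · simp only [piecewise_eq_of_mem _ _ _ hi]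
      exact (measurable_pi_apply i).comp measurable_snd
    · simp only [piecewise_eq_of_notMem _ _ _ hi]
      exact (measurable_pi_apply i).comp measurable_fst
  have key : (π.prod π).map (fun z : (N → U) × (N → U) => T.piecewise z.2 z.1) = π := by
    symm
    refine Measure.pi_eq fun s hs => ?_
    rw [Measure.map_apply hm (MeasurableSet.univ_pi hs)]
    have e : (fun z : (N → U) × (N → U) => T.piecewise z.2 z.1) ⁻¹' (Set.univ.pi s)
        = (Set.univ.pi fun i => if i ∈ T then Set.univ else s i) ×ˢ
          (Set.univ.pi fun i => if i ∈ T then s i else Set.univ) := by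
      ext z
      simp only [Set.mem_preimage, Set.mem_pi, Set.mem_univ, true_implies, Set.mem_prod]
      rw [← forall_and]
      refine forall_congr' fun i => ?_
      by_cases hi : i ∈ T <;> simp [hi]
    rw [e, Measure.prod_prod, hπ, Measure.pi_pi, Measure.pi_pi, ← prod_mul_distrib]
    refine prod_congr rfl fun i _ => ?_
    by_cases hi : i ∈ T <;> simp [hi]
  conv_lhs => rw [← key]
  rw [lintegral_map hf hm]
  exact lintegral_prod _ (hf.comp hm).aemeasurable

theorem lintegral_quadratic_form_le {U : Type*} [MeasurableSpace U] {P : Measure U}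
    {ι : Type*} [Fintype ι] [DecidableEq ι] {Y : U → ι → ℝ} (hY : Measurable Y) {σ : ℝ}
    (hσ : ∀ v : ι → ℝ, ∫⁻ u, ENNReal.ofReal ((v ⬝ᵥ Y u) ^ 2) ∂P ≤
      ENNReal.ofReal (σ * ∑ a, v a ^ 2))
    {M : Matrix ι ι ℝ} (hM : M.PosSemidef) :
    ∫⁻ u, ENNReal.ofReal (Y u ⬝ᵥ M *ᵥ Y u) ∂P ≤ ENNReal.ofReal σ * ENNReal.ofReal M.trace := by
  obtain ⟨V, l, hV, hV', hl, rfl⟩ := hM.exists_orthogonal_diagonalization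
  rw [trace_mul_comm, ← Matrix.mul_assoc, hV, Matrix.one_mul, trace_diagonal,
    ENNReal.ofReal_sum_of_nonneg fun a _ => hl a, mul_sum]
  have e : ∀ u, ENNReal.ofReal (Y u ⬝ᵥ (V * diagonal l * Vᵀ) *ᵥ Y u)
      = ∑ a, ENNReal.ofReal (l a) * ENNReal.ofReal (((fun i => V i a) ⬝ᵥ Y u) ^ 2) := by
    intro u
    rw [dotProduct_conj_mulVec, dotProduct, ENNReal.ofReal_sum_of_nonneg]
    · refine sum_congr rfl fun a _ => ?_
      rw [← ENNReal.ofReal_mul (hl a), mulVec_diagonal]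
      congr 1
      simp only [mulVec, transpose_apply]
      ring
    · intro a _
      rw [mulVec_diagonal]
      have := hl a
      nlinarith [mul_nonneg this (sq_nonneg ((Vᵀ *ᵥ Y u) a))]
  have hm : ∀ w : ι → ℝ, Measurable fun u => ENNReal.ofReal ((w ⬝ᵥ Y u) ^ 2) := fun w => by
    have : ∀ a, Measurable fun u => Y u a := fun a => (measurable_pi_apply a).comp hY
    unfold dotProduct
    fun_prop
  simp only [e]
  rw [lintegral_finsetSum univ fun a _ => (hm (fun i => V i a)).const_mul _]
  refine sum_le_sum fun a _ => ?_
  rw [lintegral_const_mul _ (hm _), mul_comm]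
  refine mul_le_mul_left ((hσ _).trans (le_of_eq ?_)) _
  have : ∑ i, V i a ^ 2 = 1 := by
    have h := congrFun (congrFun hV a) a
    rw [mul_apply, one_apply_eq] at h
    rw [← h]
    exact sum_congr rfl fun i _ => by rw [pow_two, transpose_apply]
  rw [this, mul_one]

theorem measurable_trace_gramSum_pow {N ι : Type*} [Finite N] [Fintype ι]
    [DecidableEq ι] (J : Finset N) (c : ℝ) (p : ℕ) :
    Measurable fun y : N → ι → ℝ =>
      ((gramSum J y + c • (1 : Matrix ι ι ℝ)) ^ p).trace := by
  have : Continuous fun y : N → ι → ℝ =>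
      ((gramSum J y + c • (1 : Matrix ι ι ℝ)) ^ p).trace := by
    unfold gramSum
    refine Continuous.matrix_trace (Continuous.pow (Continuous.add ?_ continuous_const) p)
    exact continuous_finsetSum _ fun j _ =>
      Continuous.matrix_vecMulVec (continuous_apply j) (continuous_apply j)
  exact this.measurable

/-- A moment bound of matrix Chernoff type: for bounded i.i.d. vectors `Y_j` in `ℝ^ι` with
`‖Y_j‖² ≤ R` and `E ⟨v, Y_j⟩² ≤ σ ‖v‖²`, the `p`-th trace moment of `∑_{j ∈ J} Y_j Y_jᵀ + c` is at
most `|ι| (|J| σ + c + p R) ^ p`. -/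
theorem lintegral_trace_gramSum_pow_le {U : Type*} [MeasurableSpace U] {P : Measure U}
    [IsProbabilityMeasure P] {N ι : Type*} [Fintype N] [DecidableEq N] [Fintype ι] [DecidableEq ι]
    {Y : U → ι → ℝ} (hY : Measurable Y) {σ R : ℝ} (hσ0 : 0 ≤ σ) (hR0 : 0 ≤ R)
    (hR : ∀ u, ∑ a, Y u a ^ 2 ≤ R)
    (hσ : ∀ v : ι → ℝ, ∫⁻ u, ENNReal.ofReal ((v ⬝ᵥ Y u) ^ 2) ∂P ≤
      ENNReal.ofReal (σ * ∑ a, v a ^ 2)) (p : ℕ) :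
    ∀ (J : Finset N) (c : ℝ), 0 ≤ c →
      ∫⁻ x, ENNReal.ofReal
          ((gramSum J (fun j => Y (x j)) + c • (1 : Matrix ι ι ℝ)) ^ p).trace
          ∂Measure.pi (fun _ : N => P)
        ≤ ENNReal.ofReal (Fintype.card ι * (#J * σ + (c + p * R)) ^ p) := by
  have hYx : Measurable fun (x : N → U) (j : N) => Y (x j) :=
    measurable_pi_lambda _ fun j => hY.comp (measurable_pi_apply j)
  have hmeas : ∀ (J : Finset N) (c : ℝ) (p : ℕ), Measurable fun x : N → U => ENNReal.ofReal
      ((gramSum J (fun j => Y (x j)) + c • (1 : Matrix ι ι ℝ)) ^ p).trace := fun J c p =>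
    ((measurable_trace_gramSum_pow J c p).comp hYx).ennreal_ofReal
  induction p with
  | zero => intro J c _; simp
  | succ p ih =>
    intro J c hc
    set π := Measure.pi (fun _ : N => P) with hπ
    have hq : ∀ j, Measurable fun x : N → U => ENNReal.ofReal
        (Y (x j) ⬝ᵥ ((gramSum (J.erase j) (fun j => Y (x j)) + (c + R) • (1 : Matrix ι ι ℝ)) ^ p)
          *ᵥ Y (x j)) := by
      intro j
      have : Continuous fun y : N → ι → ℝ =>
          y j ⬝ᵥ ((gramSum (J.erase j) y + (c + R) • (1 : Matrix ι ι ℝ)) ^ p) *ᵥ y j := by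
        unfold gramSum
        refine Continuous.dotProduct (continuous_apply j) (Continuous.matrix_mulVec
          (Continuous.pow (Continuous.add ?_ continuous_const) p) (continuous_apply j))
        exact continuous_finsetSum _ fun j _ =>
          Continuous.matrix_vecMulVec (continuous_apply j) (continuous_apply j)
      exact (this.measurable.comp hYx).ennreal_ofReal
    have hstep : ∀ j ∈ J, ∫⁻ x, ENNReal.ofReal
        (Y (x j) ⬝ᵥ ((gramSum (J.erase j) (fun j => Y (x j)) + (c + R) • (1 : Matrix ι ι ℝ)) ^ p)
          *ᵥ Y (x j)) ∂π
        ≤ ENNReal.ofReal σ *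
          ENNReal.ofReal (Fintype.card ι * (#J * σ + (c + (p + 1) * R)) ^ p) := by
      intro j hj
      rw [hπ, lintegral_pi_eq_lintegral_piecewise {j} (hq j), ← hπ]
      calc _ ≤ ∫⁻ x, ENNReal.ofReal σ * ENNReal.ofReal
            ((gramSum (J.erase j) (fun j => Y (x j)) + (c + R) • (1 : Matrix ι ι ℝ)) ^ p).trace
              ∂π := by
            refine lintegral_mono fun x => ?_
            have e : ∀ y : N → U, gramSum (J.erase j)
                (fun i => Y ((({j} : Finset N).piecewise y x) i)) =
                gramSum (J.erase j) (fun i => Y (x i)) := by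
              intro y
              refine sum_congr rfl fun i hi => ?_
              have : ({j} : Finset N).piecewise y x i = x i := by
                rw [piecewise_eq_of_notMem]
                simpa using ne_of_mem_erase hi
              simp only [this]
            simp only [e]
            simp only [piecewise_eq_of_mem _ _ _ (mem_singleton_self j)]
            refine le_trans (le_of_eq ?_) (lintegral_quadratic_form_le hY hσ
              ((gramSum_add_smul_one_posSemidef (J.erase j) (fun i => Y (x i))
                (add_nonneg hc hR0)).pow p))
            refine (measurePreserving_eval (fun _ : N => P) j).lintegral_comp
              (f := fun u => ENNReal.ofReal (Y u ⬝ᵥ ((gramSum (J.erase j) (fun i => Y (x i)) +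
                (c + R) • (1 : Matrix ι ι ℝ)) ^ p) *ᵥ Y u)) ?_
            have : ∀ a, Measurable fun u => Y u a := fun a => (measurable_pi_apply a).comp hY
            unfold mulVec dotProduct
            fun_prop
        _ ≤ _ := by
            rw [lintegral_const_mul _ (hmeas _ _ _)]
            refine mul_le_mul_right ((ih _ _ (add_nonneg hc hR0)).trans
              (ENNReal.ofReal_le_ofReal ?_)) _
            have h1 : ((#(J.erase j) : ℕ) : ℝ) ≤ #J := by
              exact_mod_cast card_le_card (erase_subset _ _)
            have h2 : (#(J.erase j) : ℝ) * σ + (c + R + p * R) ≤ #J * σ + (c + (p + 1) * R) := by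
              nlinarith [mul_le_mul_of_nonneg_right h1 hσ0]
            gcongr
    have hX : 0 ≤ #J * σ + (c + (p + 1) * R) := by positivity
    calc ∫⁻ x, ENNReal.ofReal
          ((gramSum J (fun j => Y (x j)) + c • (1 : Matrix ι ι ℝ)) ^ (p + 1)).trace ∂π
        ≤ ∫⁻ x, (∑ j ∈ J, ENNReal.ofReal (Y (x j) ⬝ᵥ ((gramSum (J.erase j) (fun j => Y (x j))
              + (c + R) • (1 : Matrix ι ι ℝ)) ^ p) *ᵥ Y (x j))
            + ENNReal.ofReal c * ENNReal.ofReal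
              ((gramSum J (fun j => Y (x j)) + c • (1 : Matrix ι ι ℝ)) ^ p).trace) ∂π := by
          refine lintegral_mono fun x => ?_
          rw [← ENNReal.ofReal_mul hc, ← ENNReal.ofReal_sum_of_nonneg, ← ENNReal.ofReal_add]
          · exact ENNReal.ofReal_le_ofReal
              (trace_gramSum_pow_succ_le J (fun j => Y (x j)) hc (fun j _ => hR _) p)
          · exact sum_nonneg fun j _ => by
              simpa using ((gramSum_add_smul_one_posSemidef (J.erase j) (fun i => Y (x i))
                (add_nonneg hc hR0)).pow p).dotProduct_mulVec_nonneg (Y (x j))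
          · exact mul_nonneg hc
              ((gramSum_add_smul_one_posSemidef J (fun i => Y (x i)) hc).pow p).trace_nonneg
          · exact fun j _ => by
              simpa using ((gramSum_add_smul_one_posSemidef (J.erase j) (fun i => Y (x i))
                (add_nonneg hc hR0)).pow p).dotProduct_mulVec_nonneg (Y (x j))
      _ ≤ ∑ _j ∈ J, ENNReal.ofReal σ *
            ENNReal.ofReal (Fintype.card ι * (#J * σ + (c + (p + 1) * R)) ^ p)
          + ENNReal.ofReal c *
            ENNReal.ofReal (Fintype.card ι * (#J * σ + (c + (p + 1) * R)) ^ p) := by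
          rw [lintegral_add_right _ ((hmeas _ _ _).const_mul _),
            lintegral_finsetSum _ fun j _ => hq j, lintegral_const_mul _ (hmeas _ _ _)]
          refine add_le_add (sum_le_sum hstep) (mul_le_mul_right ((ih _ _ hc).trans
            (ENNReal.ofReal_le_ofReal ?_)) _)
          have h2 : (#J : ℝ) * σ + (c + p * R) ≤ #J * σ + (c + (p + 1) * R) := by linarith
          gcongr
      _ ≤ _ := by
          rw [sum_const, nsmul_eq_mul, ← ENNReal.ofReal_natCast, ← ENNReal.ofReal_mul hσ0,
            ← ENNReal.ofReal_mul (by positivity), ← ENNReal.ofReal_mul hc,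
            ← ENNReal.ofReal_add (by positivity) (by positivity)]
          refine ENNReal.ofReal_le_ofReal ?_
          push_cast
          have h3 : (#J : ℝ) * σ + c ≤ #J * σ + (c + (p + 1) * R) := by
            have : 0 ≤ ((p : ℝ) + 1) * R := by positivity
            linarith
          calc _ = (Fintype.card ι * (#J * σ + (c + (p + 1) * R)) ^ p) * (#J * σ + c) := by ring
            _ ≤ (Fintype.card ι * (#J * σ + (c + (p + 1) * R)) ^ p)
                * (#J * σ + (c + (p + 1) * R)) :=
              mul_le_mul_of_nonneg_left h3 (by positivity)
            _ = _ := by ring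

/-! ### The operator norm of a matrix with independent rows -/

theorem sum_mulVec_rows_sq_le {n : ℕ} (y : Fin n → Fin n → ℝ) {R b : ℝ} (hR : 0 < R) (hb : 0 < b)
    (q : ℕ) (v : Fin n → ℝ) :
    ∑ j, (Matrix.of y *ᵥ v) j ^ 2 ≤
      (b + (gramSum univ (fun j => if ∑ k, y j k ^ 2 ≤ R then y j else 0) ^ (q + 1)).trace / b ^ q
        + ∑ j, (∑ k, y j k ^ 2) ^ (q + 1) / R ^ q) * ∑ k, v k ^ 2 := by
  set y' : Fin n → Fin n → ℝ := fun j => if ∑ k, y j k ^ 2 ≤ R then y j else 0 with hy'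
  have h1 := quadratic_form_le_trace_pow (gramSum_posSemidef univ y') hb q v
  have e : v ⬝ᵥ gramSum univ y' *ᵥ v = ∑ j, (y' j ⬝ᵥ v) ^ 2 := by
    rw [gramSum, sum_mulVec, dotProduct_sum]
    refine sum_congr rfl fun j _ => ?_
    rw [vecMulVec_mulVec, pow_two, dotProduct_comm v]
    simp
  rw [e] at h1
  rw [add_mul, sum_mul]
  refine le_trans ?_ (add_le_add h1 le_rfl)
  rw [← sum_add_distrib]
  refine sum_le_sum fun j _ => ?_
  have hz : 0 ≤ ∑ k, y j k ^ 2 := sum_nonneg fun k _ => sq_nonneg _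
  have hv : 0 ≤ ∑ k, v k ^ 2 := sum_nonneg fun k _ => sq_nonneg _
  change (y j ⬝ᵥ v) ^ 2 ≤ _
  by_cases h : ∑ k, y j k ^ 2 ≤ R
  · have : y' j = y j := by simp only [hy', if_pos h]
    rw [this]
    have : 0 ≤ (∑ k, y j k ^ 2) ^ (q + 1) / R ^ q * ∑ k, v k ^ 2 := by positivity
    linarith
  · have : (y j ⬝ᵥ v) ^ 2 ≤ (∑ k, y j k ^ 2) * ∑ k, v k ^ 2 := sum_mul_sq_le_sq_mul_sq _ _ _
    have h3 : ∑ k, y j k ^ 2 ≤ (∑ k, y j k ^ 2) ^ (q + 1) / R ^ q := by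
      rw [le_div_iff₀ (by positivity), pow_succ']
      exact mul_le_mul_of_nonneg_left (pow_le_pow_left₀ hR.le (not_le.1 h).le q) hz
    have h4 := mul_le_mul_of_nonneg_right h3 hv
    have h5 := sq_nonneg (y' j ⬝ᵥ v)
    linarith

/-- For a matrix with i.i.d. rows distributed as `Y`, where `E ⟨v, Y⟩² ≤ σ ‖v‖²` and
`E ‖Y‖ ^ (2 s) ≤ M ^ s` with `s` of order `log n`, the expected squared operator norm is of order
`n σ + s M`. -/
theorem lintegral_rows_matrixOpNorm_sq_le {U : Type*} [MeasurableSpace U] {P : Measure U}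
    [IsProbabilityMeasure P] {n s : ℕ} (hs : 1 ≤ s) (hn : n ≤ 3 ^ (s + 1)) {Y : U → Fin n → ℝ}
    (hY : Measurable Y) {σ M : ℝ} (hσ0 : 0 ≤ σ) (hM0 : 0 < M)
    (hσ : ∀ v : Fin n → ℝ, ∫⁻ u, ENNReal.ofReal ((v ⬝ᵥ Y u) ^ 2) ∂P ≤
      ENNReal.ofReal (σ * ∑ a, v a ^ 2))
    (hM : ∫⁻ u, ENNReal.ofReal ((∑ a, Y u a ^ 2) ^ s) ∂P ≤ ENNReal.ofReal (M ^ s)) :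
    ∫⁻ x, ENNReal.ofReal (matrixOpNorm (Matrix.of fun j k => Y (x j) k) ^ 2)
        ∂Measure.pi (fun _ : Fin n => P)
      ≤ ENNReal.ofReal (18 * (n * σ + 3 * s * M) + 9 * M) := by
  obtain ⟨q, rfl⟩ : ∃ q, s = q + 1 := ⟨s - 1, by omega⟩
  set π := Measure.pi (fun _ : Fin n => P) with hπ
  -- The factor `3` makes the moments beyond the truncation level beat the number `n` of rows.
  set R : ℝ := 3 * M with hR
  have hR0 : 0 < R := by positivity
  set B : ℝ := n * σ + ((q + 1 : ℕ) : ℝ) * R with hB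
  have hB0 : 0 < B := by positivity
  -- Since `n ≤ 9 ^ s`, the factor `9` absorbs the dimension `n` in the trace moment.
  set b : ℝ := 9 * B with hb
  have hb0 : 0 < b := by positivity
  set Y' : U → Fin n → ℝ := fun u => if ∑ a, Y u a ^ 2 ≤ R then Y u else 0 with hY'
  have hYa : ∀ a, Measurable fun u => Y u a := fun a => (measurable_pi_apply a).comp hY
  have hZ : Measurable fun u => ∑ a, Y u a ^ 2 := by fun_prop
  have hY'm : Measurable Y' := Measurable.ite (measurableSet_le hZ measurable_const) hY
    measurable_const
  have hY'R : ∀ u, ∑ a, Y' u a ^ 2 ≤ R := by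
    intro u
    by_cases h : ∑ a, Y u a ^ 2 ≤ R
    · simpa only [hY', if_pos h] using h
    · simpa only [hY', if_neg h, Pi.zero_apply, zero_pow two_ne_zero, sum_const_zero] using hR0.le
  have hY'σ : ∀ v : Fin n → ℝ, ∫⁻ u, ENNReal.ofReal ((v ⬝ᵥ Y' u) ^ 2) ∂P ≤
      ENNReal.ofReal (σ * ∑ a, v a ^ 2) := by
    refine fun v => (lintegral_mono fun u => ENNReal.ofReal_le_ofReal ?_).trans (hσ v)
    by_cases h : ∑ a, Y u a ^ 2 ≤ R
    · simp only [hY', if_pos h, le_refl]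
    · simp only [hY', if_neg h, dotProduct_zero, zero_pow two_ne_zero]
      positivity
  have htr := lintegral_trace_gramSum_pow_le hY'm hσ0 hR0.le hY'R hY'σ (q + 1)
    (univ : Finset (Fin n)) 0 le_rfl
  simp only [zero_smul, add_zero, zero_add, card_univ, Fintype.card_fin, ← hB, ← hπ] at htr
  have hmtr : Measurable fun x : Fin n → U =>
      ENNReal.ofReal (gramSum univ (fun j => Y' (x j)) ^ (q + 1)).trace := by
    have := (measurable_trace_gramSum_pow (ι := Fin n) (univ : Finset (Fin n)) 0 (q + 1)).comp
      (measurable_pi_lambda (fun (x : Fin n → U) (j : Fin n) => Y' (x j))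
        fun j => hY'm.comp (measurable_pi_apply j))
    simpa [Function.comp_def] using this.ennreal_ofReal
  have hmZ : Measurable fun u => ENNReal.ofReal ((∑ a, Y u a ^ 2) ^ (q + 1)) :=
    (hZ.pow_const _).ennreal_ofReal
  have hmZ' : ∀ j : Fin n, Measurable fun x : Fin n → U =>
      ENNReal.ofReal ((∑ a, Y (x j) a ^ 2) ^ (q + 1)) := fun j =>
    hmZ.comp (measurable_pi_apply j)
  have hn' : (n : ℝ) ≤ 9 * 3 ^ q := by
    have : (n : ℝ) ≤ 3 ^ (q + 1 + 1) := by exact_mod_cast hn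
    calc (n : ℝ) ≤ 3 ^ (q + 1 + 1) := this
      _ = 9 * 3 ^ q := by ring
  calc ∫⁻ x, ENNReal.ofReal (matrixOpNorm (Matrix.of fun j k => Y (x j) k) ^ 2) ∂π
      ≤ ∫⁻ x, (ENNReal.ofReal b +
          ENNReal.ofReal (gramSum univ (fun j => Y' (x j)) ^ (q + 1)).trace
            * ENNReal.ofReal (b ^ q)⁻¹
          + ∑ j, ENNReal.ofReal ((∑ a, Y (x j) a ^ 2) ^ (q + 1))
            * ENNReal.ofReal (R ^ q)⁻¹) ∂π := by
        refine lintegral_mono fun x => ?_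
        have hnn : 0 ≤ (gramSum univ (fun j => Y' (x j)) ^ (q + 1)).trace :=
          ((gramSum_posSemidef _ _).pow _).trace_nonneg
        have hz : ∀ j, 0 ≤ ∑ a, Y (x j) a ^ 2 := fun j => sum_nonneg fun a _ => sq_nonneg _
        have hz' : ∀ j, 0 ≤ (∑ a, Y (x j) a ^ 2) ^ (q + 1) := fun j => pow_nonneg (hz j) _
        simp only [← ENNReal.ofReal_mul hnn, ← ENNReal.ofReal_mul (hz' _)]
        rw [← ENNReal.ofReal_sum_of_nonneg fun j _ => mul_nonneg (hz' j) (by positivity),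
          ← ENNReal.ofReal_add hb0.le (mul_nonneg hnn (by positivity)),
          ← ENNReal.ofReal_add (add_nonneg hb0.le (mul_nonneg hnn (by positivity)))
            (sum_nonneg fun j _ => mul_nonneg (hz' j) (by positivity))]
        refine ENNReal.ofReal_le_ofReal (matrixOpNorm_sq_le (add_nonneg (add_nonneg hb0.le
          (mul_nonneg hnn (by positivity)))
          (sum_nonneg fun j _ => mul_nonneg (hz' j) (by positivity))) fun v => ?_)
        exact sum_mulVec_rows_sq_le (fun j k => Y (x j) k) hR0 hb0 q v
    _ ≤ ENNReal.ofReal b + ENNReal.ofReal (n * B ^ (q + 1)) * ENNReal.ofReal (b ^ q)⁻¹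
          + ∑ _j : Fin n, ENNReal.ofReal (M ^ (q + 1)) * ENNReal.ofReal (R ^ q)⁻¹ := by
        have hm1 : Measurable fun x : Fin n → U => ENNReal.ofReal b +
            ENNReal.ofReal (gramSum univ (fun j => Y' (x j)) ^ (q + 1)).trace
              * ENNReal.ofReal (b ^ q)⁻¹ := (hmtr.mul_const _).const_add _
        rw [lintegral_add_left hm1, lintegral_add_left measurable_const, lintegral_const,
          measure_univ, mul_one, lintegral_mul_const _ hmtr,
          lintegral_finsetSum _ fun j _ => (hmZ' j).mul_const _]
        refine add_le_add (add_le_add le_rfl (mul_le_mul_left htr _)) (sum_le_sum fun j _ => ?_)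
        rw [lintegral_mul_const _ (hmZ' j)]
        refine mul_le_mul_left (le_trans (le_of_eq ?_) hM) _
        exact (measurePreserving_eval (fun _ : Fin n => P) j).lintegral_comp hmZ
    _ ≤ _ := by
        rw [sum_const, card_univ, Fintype.card_fin, nsmul_eq_mul, ← ENNReal.ofReal_natCast,
          ← ENNReal.ofReal_mul (by positivity), ← ENNReal.ofReal_mul (by positivity),
          ← ENNReal.ofReal_mul (by positivity), ← ENNReal.ofReal_add (by positivity)
          (by positivity), ← ENNReal.ofReal_add (by positivity) (by positivity)]
        refine ENNReal.ofReal_le_ofReal ?_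
        have e1 : (n : ℝ) * B ^ (q + 1) * (b ^ q)⁻¹ ≤ b := by
          rw [hb, mul_pow, pow_succ]
          have : (n : ℝ) ≤ 9 * 9 ^ q :=
            hn'.trans (mul_le_mul_of_nonneg_left (pow_le_pow_left₀ (by norm_num) (by norm_num) q)
              (by norm_num))
          have hBq : B ^ q ≠ 0 := by positivity
          rw [← div_eq_mul_inv, div_le_iff₀ (by positivity)]
          nlinarith [mul_le_mul_of_nonneg_right this (show 0 ≤ B ^ q * B by positivity)]
        have e2 : (n : ℝ) * (M ^ (q + 1) * (R ^ q)⁻¹) ≤ 9 * M := by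
          rw [hR, mul_pow, pow_succ, ← div_eq_mul_inv, ← mul_div_assoc,
            div_le_iff₀ (by positivity)]
          nlinarith [mul_le_mul_of_nonneg_right hn' (show 0 ≤ M ^ q * M by positivity)]
        have e3 : b + b = 18 * (n * σ + 3 * ((q + 1 : ℕ) : ℝ) * M) := by
          rw [hb, hB, hR]; ring
        linarith

/-! ### Hypercontractivity bounds the dimension -/

/-- The coordinate of the tensor power `x ^ ⊗s` along the symmetric tensor indexed by `k`,
normalised so that these coordinates form an orthonormal system. -/
noncomputable def symTensorCoord {D s : ℕ} (k : Sym (Fin D) s) (x : Fin D → ℝ) : ℝ :=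
  √k.val.countPerms * (k.val.map x).prod

theorem sum_symTensorCoord_mul {D s : ℕ} (x y : Fin D → ℝ) :
    ∑ k : Sym (Fin D) s, symTensorCoord k x * symTensorCoord k y = (x ⬝ᵥ y) ^ s := by
  rw [dotProduct, sum_pow, sym_univ]
  refine sum_congr rfl fun k _ => ?_
  rw [Multiset.prod_map_mul]
  have := Real.mul_self_sqrt (Nat.cast_nonneg (α := ℝ) k.val.countPerms)
  unfold symTensorCoord
  linear_combination (k.val.map x).prod * (k.val.map y).prod * this

theorem sum_symTensorCoord_sq {D s : ℕ} (x : Fin D → ℝ) :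
    ∑ k : Sym (Fin D) s, symTensorCoord k x ^ 2 = (∑ l, x l ^ 2) ^ s := by
  simp only [pow_two]
  exact sum_symTensorCoord_mul x x

theorem continuous_symTensorCoord {D s : ℕ} (k : Sym (Fin D) s) :
    Continuous (symTensorCoord k) := by
  unfold symTensorCoord
  exact continuous_const.mul (continuous_multiset_prod _ fun i _ => continuous_apply i)

/-- If the `2 s`-th moments of the linear combinations of `D ≤ s` normalised functions `v l` are
bounded by `A ^ s` times the corresponding power of the Euclidean norm, then `A` is at least
`D / 4`.  With `w` the tensor power `v ^ ⊗s`, the assumption at the random coefficient vector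
`a = v u'` bounds `E ⟨w u, w u'⟩² = ‖E w wᵀ‖_F²`, which is at least `(Tr E w wᵀ)²` divided by the
dimension of the space of symmetric tensors, itself at most `4 ^ s`. -/
theorem dimension_le_of_moment_bound {U : Type*} [MeasurableSpace U] {P : Measure U}
    [IsProbabilityMeasure P] {D s : ℕ} (hD : D ≤ s) {v : U → Fin D → ℝ} (hv : Measurable v)
    (hnorm : ∀ l, ∫ u, v u l ^ 2 ∂P = 1) (hint : Integrable (fun u => (∑ l, v u l ^ 2) ^ s) P)
    {A : ℝ} (hA : 0 ≤ A)
    (hHC : ∀ a : Fin D → ℝ, ∫ u, (a ⬝ᵥ v u) ^ (2 * s) ∂P ≤ A ^ s * (∑ l, a l ^ 2) ^ s) :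
    (D : ℝ) ≤ 4 * A := by
  rcases Nat.eq_zero_or_pos D with rfl | hD0
  · simpa using hA
  set Q : U → ℝ := fun u => ∑ l, v u l ^ 2 with hQ
  have hQ0 : ∀ u, 0 ≤ Q u := fun u => sum_nonneg fun l _ => sq_nonneg _
  set κ : ℝ := ∫ u, Q u ^ s ∂P with hκ
  have hw : ∀ k : Sym (Fin D) s, Measurable fun u => symTensorCoord k (v u) := fun k =>
    (continuous_symTensorCoord k).measurable.comp hv
  have hle : ∀ (k : Sym (Fin D) s) u, symTensorCoord k (v u) ^ 2 ≤ Q u ^ s := fun k u => by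
    rw [← sum_symTensorCoord_sq (s := s) (v u)]
    exact single_le_sum (f := fun k : Sym (Fin D) s => symTensorCoord k (v u) ^ 2)
      (fun _ _ => sq_nonneg _) (mem_univ k)
  have hww : ∀ k k' : Sym (Fin D) s,
      Integrable (fun u => symTensorCoord k (v u) * symTensorCoord k' (v u)) P := fun k k' => by
    refine hint.mono' ((hw k).mul (hw k')).aestronglyMeasurable (ae_of_all _ fun u => ?_)
    rw [Real.norm_eq_abs, abs_le]
    constructor <;> nlinarith [hle k u, hle k' u,
      sq_nonneg (symTensorCoord k (v u) + symTensorCoord k' (v u)),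
      sq_nonneg (symTensorCoord k (v u) - symTensorCoord k' (v u))]
  set G : Sym (Fin D) s → Sym (Fin D) s → ℝ := fun k k' =>
    ∫ u, symTensorCoord k (v u) * symTensorCoord k' (v u) ∂P with hG
  have hpt : ∀ u', ∑ k, ∑ k', symTensorCoord k (v u') * symTensorCoord k' (v u') * G k k'
      ≤ A ^ s * Q u' ^ s := by
    intro u'
    refine le_trans (le_of_eq ?_) (hHC (v u'))
    have e : ∀ u, (v u' ⬝ᵥ v u) ^ (2 * s) = ∑ k : Sym (Fin D) s, ∑ k' : Sym (Fin D) s,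
        (symTensorCoord k (v u') * symTensorCoord k' (v u')) *
          (symTensorCoord k (v u) * symTensorCoord k' (v u)) := by
      intro u
      rw [mul_comm 2 s, pow_mul, ← sum_symTensorCoord_mul, pow_two, sum_mul_sum]
      exact sum_congr rfl fun k _ => sum_congr rfl fun k' _ => by ring
    simp only [e]
    rw [integral_finsetSum _ fun k _ => integrable_finsetSum _ fun k' _ => (hww k k').const_mul _]
    refine sum_congr rfl fun k _ => ?_
    rw [integral_finsetSum _ fun k' _ => (hww k k').const_mul _]
    exact sum_congr rfl fun k' _ => by rw [integral_const_mul]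
  have hF : ∑ k, ∑ k', G k k' ^ 2 ≤ A ^ s * κ := by
    have h := integral_mono (integrable_finsetSum _ fun k _ => integrable_finsetSum _ fun k' _ =>
      (hww k k').mul_const (G k k')) (hint.const_mul (A ^ s)) hpt
    rw [integral_const_mul, integral_finsetSum _ fun k _ => integrable_finsetSum _ fun k' _ =>
      (hww k k').mul_const (G k k')] at h
    refine le_trans (le_of_eq (sum_congr rfl fun k _ => ?_)) h
    rw [integral_finsetSum _ fun k' _ => (hww k k').mul_const (G k k')]
    exact sum_congr rfl fun k' _ => by rw [integral_mul_const, pow_two]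
  have htr : ∑ k, G k k = κ := by
    rw [hκ, hG, ← integral_finsetSum _ fun k _ => hww k k]
    refine integral_congr_ae (ae_of_all _ fun u => ?_)
    simp only [← pow_two, hQ, sum_symTensorCoord_sq]
  have hcard : ((Fintype.card (Sym (Fin D) s) : ℕ) : ℝ) ≤ 4 ^ s := by
    rw [Sym.card_sym_eq_multichoose, Fintype.card_fin, Nat.multichoose_eq]
    have h1 : (D + s - 1).choose s ≤ 2 ^ (2 * s) :=
      (Nat.choose_le_two_pow _ _).trans (Nat.pow_le_pow_right (by norm_num) (by omega))
    rw [pow_mul] at h1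
    exact_mod_cast h1
  have hCS : κ ^ 2 ≤ 4 ^ s * (A ^ s * κ) := by
    have h1 : (∑ k, G k k) ^ 2 ≤ Fintype.card (Sym (Fin D) s) * ∑ k, G k k ^ 2 := by
      simpa using sq_sum_le_card_mul_sum_sq (s := univ) (f := fun k => G k k)
    rw [htr] at h1
    refine h1.trans (mul_le_mul hcard (le_trans ?_ hF) (sum_nonneg fun k _ => sq_nonneg _)
      (by positivity))
    exact sum_le_sum fun k _ => single_le_sum (f := fun k' => G k k' ^ 2)
      (fun _ _ => sq_nonneg _) (mem_univ k)
  have hQint : Integrable Q P := by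
    refine integrable_finsetSum _ fun l _ => ?_
    by_contra h
    have := integral_undef h
    rw [hnorm l] at this
    exact one_ne_zero this
  have hEQ : ∫ u, Q u ∂P = D := by
    rw [hQ, integral_finsetSum]
    · simp [hnorm]
    · intro l _
      by_contra h
      have := integral_undef h
      rw [hnorm l] at this
      exact one_ne_zero this
  have hJ : (D : ℝ) ^ s ≤ κ := by
    rw [← hEQ]
    exact (convexOn_pow s).map_integral_le (continuous_pow s).continuousOn isClosed_Ici
      (ae_of_all _ fun u => hQ0 u) hQint hint
  have hκ0 : 0 < κ := lt_of_lt_of_le (by positivity) hJ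
  have h5 : κ ≤ (4 * A) ^ s := by
    rw [mul_pow]
    refine le_of_mul_le_mul_right ?_ hκ0
    linarith [pow_two κ]
  exact (pow_le_pow_iff_left₀ (by positivity) (by positivity) (by omega : s ≠ 0)).1 (hJ.trans h5)

/-! ### Decoupling -/

/-- The matrix `A` with its diagonal replaced by zero. -/
def offDiagonal {n : ℕ} (A : Matrix (Fin n) (Fin n) ℝ) : Matrix (Fin n) (Fin n) ℝ :=
  Matrix.of fun i j => if i = j then 0 else A i j

/-- The block of `A` with rows in `T` and columns outside `T`; the other entries are zero. -/
def decoupledBlock {n : ℕ} (T : Finset (Fin n)) (A : Matrix (Fin n) (Fin n) ℝ) :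
    Matrix (Fin n) (Fin n) ℝ :=
  Matrix.of fun i j => if i ∈ T ∧ j ∉ T then A i j else 0

/-- A quarter of all sets separate `i` from `j` in the given order. -/
theorem four_mul_card_separating {n : ℕ} {i j : Fin n} (hij : i ≠ j) :
    4 * #{T : Finset (Fin n) | i ∈ T ∧ j ∉ T} = 2 ^ n := by
  have h : #{T : Finset (Fin n) | i ∈ T ∧ j ∉ T} =
      #((univ \ {i, j} : Finset (Fin n)).powerset) := by
    refine card_nbij' (fun T => T.erase i) (fun T => insert i T) ?_ ?_ ?_ ?_
    · intro T hT
      simp only [coe_filter, mem_univ, true_and, Set.mem_ofPred_eq] at hT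
      simp only [coe_powerset, Set.mem_preimage, Set.mem_powerset_iff, coe_subset]
      intro k hk
      have := mem_erase.1 hk
      simp only [mem_sdiff, mem_univ, mem_insert, mem_singleton, true_and, not_or]
      exact ⟨this.1, fun h => hT.2 (h ▸ this.2)⟩
    · intro T hT
      simp only [coe_powerset, Set.mem_preimage, Set.mem_powerset_iff, coe_subset] at hT
      simp only [coe_filter, mem_univ, true_and, Set.mem_ofPred_eq, mem_insert_self, mem_insert,
        not_or]
      refine ⟨hij.symm, fun h => ?_⟩
      have := hT h
      simp at this
    · intro T hT
      simp only [coe_filter, mem_univ, true_and, Set.mem_ofPred_eq] at hT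
      exact insert_erase hT.1
    · intro T hT
      simp only [coe_powerset, Set.mem_preimage, Set.mem_powerset_iff, coe_subset] at hT
      refine erase_insert fun h => ?_
      have := hT h
      simp at this
  have hn : 2 ≤ n := by
    have := card_le_univ ({i, j} : Finset (Fin n))
    rwa [card_pair hij, Fintype.card_fin] at this
  rw [h, card_powerset, card_sdiff_of_subset (subset_univ _), card_pair hij, card_univ,
    Fintype.card_fin]
  obtain ⟨k, rfl⟩ : ∃ k, n = k + 2 := ⟨n - 2, by omega⟩
  rw [Nat.add_sub_cancel, pow_add]
  ring

theorem matrixOpNorm_offDiagonal_le_decoupled {n : ℕ} (A : Matrix (Fin n) (Fin n) ℝ) :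
    matrixOpNorm (offDiagonal A) ≤
      4 / 2 ^ n * ∑ T : Finset (Fin n), matrixOpNorm (decoupledBlock T A) := by
  have e : offDiagonal A = (4 / 2 ^ n : ℝ) • ∑ T : Finset (Fin n), decoupledBlock T A := by
    ext i j
    rw [Matrix.smul_apply, Matrix.sum_apply, smul_eq_mul]
    simp only [offDiagonal, decoupledBlock, of_apply]
    by_cases hij : i = j
    · subst hij
      simp
    · rw [if_neg hij, sum_ite, sum_const_zero, add_zero, sum_const, nsmul_eq_mul]
      have h : (4 : ℝ) * #{T : Finset (Fin n) | i ∈ T ∧ j ∉ T} = 2 ^ n := by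
        exact_mod_cast four_mul_card_separating hij
      have h2 : (2 : ℝ) ^ n ≠ 0 := by positivity
      field_simp
      linear_combination (-A i j) * h
  rw [e, matrixOpNorm_smul, abs_of_nonneg (by positivity)]
  exact mul_le_mul_of_nonneg_left (matrixOpNorm_sum_le _ _) (by positivity)

theorem measurable_matrixOpNorm {Z : Type*} [MeasurableSpace Z] {n : ℕ}
    {B : Z → Matrix (Fin n) (Fin n) ℝ} (hB : ∀ i j, Measurable (fun z => B z i j)) :
    Measurable (fun z => matrixOpNorm (B z)) := by
  have h1 : Measurable (fun A : Fin n → Fin n → ℝ => matrixOpNorm (Matrix.of A)) :=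
    (continuous_matrixOpNorm.comp (continuous_id (X := Fin n → Fin n → ℝ))).measurable
  have h2 : Measurable (fun z => (fun i j => B z i j : Fin n → Fin n → ℝ)) :=
    measurable_pi_lambda _ fun i => measurable_pi_lambda _ fun j => hB i j
  exact h1.comp h2

/-- A second moment bound gives a first moment bound, with a free parameter `k` in place of a
square root. -/
theorem lintegral_ofReal_le_of_sq {Z : Type*} [MeasurableSpace Z] {ν : Measure Z}
    [IsProbabilityMeasure ν] {f : Z → ℝ} {k q : ℝ} (hk : 0 < k)
    (h : ∫⁻ z, ENNReal.ofReal (f z ^ 2) ∂ν ≤ ENNReal.ofReal q) (hq : 0 ≤ q) :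
    ∫⁻ z, ENNReal.ofReal (f z) ∂ν ≤ ENNReal.ofReal (k / 2 + q / (2 * k)) := by
  calc ∫⁻ z, ENNReal.ofReal (f z) ∂ν
      ≤ ∫⁻ z, (ENNReal.ofReal (k / 2)
          + ENNReal.ofReal (1 / (2 * k)) * ENNReal.ofReal (f z ^ 2)) ∂ν := by
        refine lintegral_mono fun z => ?_
        rw [← ENNReal.ofReal_mul (by positivity), ← ENNReal.ofReal_add (by positivity)
          (by positivity)]
        refine ENNReal.ofReal_le_ofReal ?_
        rw [show k / 2 + 1 / (2 * k) * f z ^ 2 = (k ^ 2 + f z ^ 2) / (2 * k) by field_simp,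
          le_div_iff₀ (by positivity)]
        nlinarith [sq_nonneg (f z - k)]
    _ ≤ ENNReal.ofReal (k / 2) + ENNReal.ofReal (1 / (2 * k)) * ENNReal.ofReal q := by
        rw [lintegral_add_left measurable_const, lintegral_const, measure_univ, mul_one,
          lintegral_const_mul' _ _ ENNReal.ofReal_ne_top]
        gcongr
    _ = _ := by
        rw [← ENNReal.ofReal_mul (by positivity), ← ENNReal.ofReal_add (by positivity)
          (by positivity)]
        congr 1
        ring

/-! ### Gram matrices of a finite feature map -/

/-- The Gram matrix of the sample `x` for the feature map `φ`. -/
def gramMatrix {U : Type*} {n d : ℕ} (φ : U → Fin d → ℝ) (x : Fin n → U) :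
    Matrix (Fin n) (Fin n) ℝ :=
  Matrix.of fun i j => φ (x i) ⬝ᵥ φ (x j)

theorem dotProduct_gramMatrix_mulVec {U : Type*} {n d : ℕ} (φ : U → Fin d → ℝ) (x : Fin n → U)
    (v : Fin n → ℝ) :
    v ⬝ᵥ gramMatrix φ x *ᵥ v = ∑ l, (∑ k, v k * φ (x k) l) ^ 2 := by
  have : gramMatrix φ x = (Matrix.of fun i l => φ (x i) l) * (Matrix.of fun i l => φ (x i) l)ᵀ := by
    ext i j
    simp [gramMatrix, mul_apply, dotProduct]
  rw [this, ← mulVec_mulVec, dotProduct_mulVec, ← mulVec_transpose, dotProduct]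
  refine sum_congr rfl fun l _ => ?_
  have : ((Matrix.of fun i l => φ (x i) l)ᵀ *ᵥ v) l = ∑ k, v k * φ (x k) l := by
    simp [mulVec, dotProduct, mul_comm]
  rw [this, pow_two]

theorem measurable_gramMatrix {U : Type*} [MeasurableSpace U] {n d : ℕ} {φ : U → Fin d → ℝ}
    (hφ : Measurable φ) (i j : Fin n) : Measurable fun x : Fin n → U => gramMatrix φ x i j := by
  have : ∀ l, Measurable fun u => φ u l := fun l => (measurable_pi_apply l).comp hφ
  have h2 : ∀ i l, Measurable fun x : Fin n → U => φ (x i) l := fun i l =>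
    (this l).comp (measurable_pi_apply i)
  simp only [gramMatrix, of_apply, dotProduct]
  fun_prop

theorem measurable_matrixOpNorm_decoupledBlock {U : Type*} [MeasurableSpace U] {n d : ℕ}
    {φ : U → Fin d → ℝ} (hφ : Measurable φ) (T : Finset (Fin n)) :
    Measurable fun x : Fin n → U => matrixOpNorm (decoupledBlock T (gramMatrix φ x)) := by
  refine measurable_matrixOpNorm fun i j => ?_
  by_cases h : i ∈ T ∧ j ∉ T
  · simpa only [decoupledBlock, of_apply, if_pos h] using measurable_gramMatrix hφ i j
  · simp only [decoupledBlock, of_apply, if_neg h, measurable_const]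

theorem measurable_matrixOpNorm_offDiagonal {U : Type*} [MeasurableSpace U] {n d : ℕ}
    {φ : U → Fin d → ℝ} (hφ : Measurable φ) :
    Measurable fun x : Fin n → U => matrixOpNorm (offDiagonal (gramMatrix φ x)) := by
  refine measurable_matrixOpNorm fun i j => ?_
  by_cases h : i = j
  · simp only [offDiagonal, of_apply, if_pos h, measurable_const]
  · simpa only [offDiagonal, of_apply, if_neg h] using measurable_gramMatrix hφ i j

theorem matrixOpNorm_gramMatrix_le {U : Type*} {n d : ℕ} (φ : U → Fin d → ℝ) (x : Fin n → U)
    {c : ℝ} (hc : 0 ≤ c) (h : ∀ i, ∑ l, φ (x i) l ^ 2 ≤ c) :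
    matrixOpNorm (gramMatrix φ x) ≤ c + matrixOpNorm (offDiagonal (gramMatrix φ x)) := by
  have e : gramMatrix φ x =
      diagonal (fun i => ∑ l, φ (x i) l ^ 2) + offDiagonal (gramMatrix φ x) := by
    ext i j
    by_cases hij : i = j
    · subst hij
      simp [offDiagonal, gramMatrix, dotProduct, pow_two]
    · simp [offDiagonal, hij]
  conv_lhs => rw [e]
  refine (matrixOpNorm_add_le _ _).trans (add_le_add ?_ le_rfl)
  refine matrixOpNorm_diagonal_le hc fun i => ?_
  rw [abs_of_nonneg (sum_nonneg fun l _ => sq_nonneg _)]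
  exact h i

/-- The conditional estimate: with the points outside `T` fixed, the rows of the decoupled block
are independent, with second moments controlled by the full Gram matrix and with high moments
controlled by hypercontractivity.  The positive number `t` keeps the weights in Jensen's
inequality away from zero. -/
theorem lintegral_decoupledBlock_conditional_le {U : Type*} [MeasurableSpace U] {P : Measure U}
    [IsProbabilityMeasure P] {n s d : ℕ} (hn1 : 1 ≤ n) (hs : 1 ≤ s) (hn : n ≤ 3 ^ (s + 1))
    {φ : U → Fin d → ℝ} (hφ : Measurable φ) {lam : Fin d → ℝ} {L A t : ℝ}
    (hlam : ∀ l, 0 ≤ lam l) (hlamL : ∀ l, lam l ≤ L) (hL : 0 < L) (hA : 0 < A) (ht : 0 < t)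
    (h2 : ∀ a : Fin d → ℝ, ∫⁻ u, ENNReal.ofReal ((a ⬝ᵥ φ u) ^ 2) ∂P ≤
      ENNReal.ofReal (∑ l, a l ^ 2 * lam l))
    (hHC : ∀ a : Fin d → ℝ, ∫⁻ u, ENNReal.ofReal ((a ⬝ᵥ φ u) ^ (2 * s)) ∂P ≤
      ENNReal.ofReal ((A * ∑ l, a l ^ 2 * lam l) ^ s))
    (T : Finset (Fin n)) (x : Fin n → U) :
    ∫⁻ y, ENNReal.ofReal (matrixOpNorm (decoupledBlock T (gramMatrix φ (T.piecewise y x))) ^ 2)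
        ∂Measure.pi (fun _ : Fin n => P)
      ≤ ENNReal.ofReal (18 * (n * (L * matrixOpNorm (gramMatrix φ x))
          + 3 * s * (A * L * (∑ k, ∑ l, φ (x k) l ^ 2 + t)))
          + 9 * (A * L * (∑ k, ∑ l, φ (x k) l ^ 2 + t))) := by
  set Y : U → Fin n → ℝ := fun u k => if k ∈ T then 0 else φ (x k) ⬝ᵥ φ u with hY
  have hφl : ∀ l, Measurable fun u => φ u l := fun l => (measurable_pi_apply l).comp hφ
  have hYm : Measurable Y := by
    refine measurable_pi_lambda _ fun k => ?_
    by_cases hk : k ∈ T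
    · simp only [hY, if_pos hk, measurable_const]
    · simp only [hY, if_neg hk, dotProduct]
      fun_prop
  set M : ℝ := A * L * (∑ k, ∑ l, φ (x k) l ^ 2 + t) with hM
  have hM0 : 0 < M := by positivity
  have hLsum : ∀ a : Fin d → ℝ, ∑ l, a l ^ 2 * lam l ≤ L * ∑ l, a l ^ 2 := fun a => by
    rw [mul_sum]
    exact sum_le_sum fun l _ => by
      rw [mul_comm]; exact mul_le_mul_of_nonneg_right (hlamL l) (sq_nonneg _)
  have hσ : ∀ v : Fin n → ℝ, ∫⁻ u, ENNReal.ofReal ((v ⬝ᵥ Y u) ^ 2) ∂P ≤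
      ENNReal.ofReal (L * matrixOpNorm (gramMatrix φ x) * ∑ k, v k ^ 2) := by
    intro v
    set w : Fin n → ℝ := fun k => if k ∈ T then 0 else v k with hw
    set a : Fin d → ℝ := fun l => ∑ k, w k * φ (x k) l with ha
    have e : ∀ u, v ⬝ᵥ Y u = a ⬝ᵥ φ u := by
      intro u
      have h1 : ∀ k, v k * Y u k = ∑ l, w k * φ (x k) l * φ u l := by
        intro k
        by_cases hk : k ∈ T
        · simp [hY, hw, hk]
        · simp only [hY, hw, if_neg hk, dotProduct, mul_sum]
          exact sum_congr rfl fun l _ => by ring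
      simp only [dotProduct, ha, sum_mul]
      rw [sum_comm]
      exact sum_congr rfl fun k _ => h1 k
    simp only [e]
    refine (h2 a).trans (ENNReal.ofReal_le_ofReal ((hLsum a).trans ?_))
    rw [mul_assoc]
    refine mul_le_mul_of_nonneg_left ?_ hL.le
    rw [ha, ← dotProduct_gramMatrix_mulVec]
    refine (dotProduct_mulVec_le_matrixOpNorm _ _).trans
      (mul_le_mul_of_nonneg_left (sum_le_sum fun k _ => ?_) (matrixOpNorm_nonneg _))
    by_cases hk : k ∈ T
    · simp only [hw, if_pos hk, zero_pow two_ne_zero]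
      positivity
    · simp only [hw, if_neg hk, le_refl]
  have hMom : ∫⁻ u, ENNReal.ofReal ((∑ k, Y u k ^ 2) ^ s) ∂P ≤ ENNReal.ofReal (M ^ s) := by
    have hn0 : (0 : ℝ) < n := by exact_mod_cast hn1
    set c : Fin n → ℝ := fun k => A * L * (∑ l, φ (x k) l ^ 2 + t / n) with hc
    have hc0 : ∀ k, 0 < c k := fun k => by positivity
    have hcM : ∑ k, c k = M := by
      rw [hc, hM, ← mul_sum, sum_add_distrib]
      congr 2
      rw [sum_const, card_univ, Fintype.card_fin, nsmul_eq_mul]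
      field_simp
    have hYk : ∀ k, ∫⁻ u, ENNReal.ofReal ((Y u k ^ 2) ^ s) ∂P ≤ ENNReal.ofReal (c k ^ s) := by
      intro k
      by_cases hk : k ∈ T
      · have : s ≠ 0 := by omega
        simp [hY, if_pos hk, this]
      · simp only [hY, if_neg hk, ← pow_mul]
        refine (hHC (φ (x k))).trans (ENNReal.ofReal_le_ofReal ?_)
        refine pow_le_pow_left₀ (mul_nonneg hA.le
          (sum_nonneg fun l _ => mul_nonneg (sq_nonneg _) (hlam l))) ?_ s
        simp only [hc]
        rw [mul_assoc]
        refine mul_le_mul_of_nonneg_left ((hLsum _).trans ?_) hA.le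
        refine mul_le_mul_of_nonneg_left ?_ hL.le
        have : 0 < t / n := by positivity
        linarith
    have hJ : ∀ u, (∑ k, Y u k ^ 2) ^ s ≤ ∑ k, c k / M * (M / c k) ^ s * (Y u k ^ 2) ^ s := by
      intro u
      have := Real.pow_arith_mean_le_arith_mean_pow univ (fun k => c k / M)
        (fun k => M / c k * Y u k ^ 2) (fun k _ => by have := hc0 k; positivity)
        (by rw [← sum_div, hcM, div_self hM0.ne'])
        (fun k _ => by have := hc0 k; positivity) s
      refine le_trans (le_of_eq ?_) (this.trans (le_of_eq ?_))
      · congr 1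
        refine sum_congr rfl fun k _ => ?_
        have := (hc0 k).ne'
        field_simp
      · exact sum_congr rfl fun k _ => by rw [mul_pow, mul_assoc]
    have hYkm : ∀ k, Measurable fun u => ENNReal.ofReal ((Y u k ^ 2) ^ s) := fun k =>
      ((((measurable_pi_apply k).comp hYm).pow_const 2).pow_const s).ennreal_ofReal
    have hck : ∀ k, 0 ≤ c k / M * (M / c k) ^ s := fun k => by have := hc0 k; positivity
    calc ∫⁻ u, ENNReal.ofReal ((∑ k, Y u k ^ 2) ^ s) ∂P
        ≤ ∫⁻ u, ∑ k, ENNReal.ofReal (c k / M * (M / c k) ^ s)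
            * ENNReal.ofReal ((Y u k ^ 2) ^ s) ∂P := by
          refine lintegral_mono fun u => ?_
          simp only [← ENNReal.ofReal_mul (hck _)]
          rw [← ENNReal.ofReal_sum_of_nonneg fun k _ => mul_nonneg (hck k) (by positivity)]
          exact ENNReal.ofReal_le_ofReal (hJ u)
      _ ≤ ∑ k, ENNReal.ofReal (c k / M * (M / c k) ^ s) * ENNReal.ofReal (c k ^ s) := by
          rw [lintegral_finsetSum _ fun k _ => (hYkm k).const_mul _]
          refine sum_le_sum fun k _ => ?_
          rw [lintegral_const_mul _ (hYkm k)]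
          exact mul_le_mul_right (hYk k) _
      _ = ENNReal.ofReal (M ^ s) := by
          simp only [← ENNReal.ofReal_mul (hck _)]
          rw [← ENNReal.ofReal_sum_of_nonneg fun k _ =>
            mul_nonneg (hck k) (pow_nonneg (hc0 k).le _)]
          congr 1
          calc _ = ∑ k, c k / M * M ^ s := sum_congr rfl fun k _ => by
                rw [mul_assoc, ← mul_pow, div_mul_cancel₀ _ (hc0 k).ne']
            _ = M ^ s := by rw [← sum_mul, ← sum_div, hcM, div_self hM0.ne', one_mul]
  refine le_trans (lintegral_mono fun y => ENNReal.ofReal_le_ofReal ?_)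
    (lintegral_rows_matrixOpNorm_sq_le hs hn hYm
      (mul_nonneg hL.le (matrixOpNorm_nonneg (gramMatrix φ x))) hM0 hσ hMom)
  refine matrixOpNorm_sq_le (sq_nonneg _) fun v => ?_
  refine le_trans (sum_le_sum fun j _ => ?_) (sum_mulVec_sq_le _ v)
  by_cases hj : j ∈ T
  · refine le_of_eq ?_
    congr 1
    simp only [mulVec, dotProduct]
    refine sum_congr rfl fun k _ => ?_
    by_cases hk : k ∈ T
    · simp [decoupledBlock, hY, hk]
    · simp [decoupledBlock, hY, hk, hj, gramMatrix, dotProduct_comm]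
  · have : (decoupledBlock T (gramMatrix φ (T.piecewise y x)) *ᵥ v) j = 0 := by
      simp [mulVec, dotProduct, decoupledBlock, hj]
    rw [this, zero_pow two_ne_zero]
    exact sq_nonneg _

theorem ofReal_sum_sum_sq {κ κ' : Type*} [Fintype κ] [Fintype κ'] (b : κ → κ' → ℝ) :
    ENNReal.ofReal (∑ i, ∑ j, b i j ^ 2) = ∑ i, ∑ j, ENNReal.ofReal (b i j ^ 2) := by
  rw [ENNReal.ofReal_sum_of_nonneg fun i _ => sum_nonneg fun j _ => sq_nonneg _]
  exact sum_congr rfl fun i _ => ENNReal.ofReal_sum_of_nonneg fun j _ => sq_nonneg _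

theorem lintegral_sum_offDiagonal_sq_le {U : Type*} [MeasurableSpace U] {P : Measure U}
    [IsProbabilityMeasure P] {n d : ℕ} {φ : U → Fin d → ℝ} (hφ : Measurable φ) {lam : Fin d → ℝ}
    (hlam : ∀ l, 0 ≤ lam l)
    (h2 : ∀ a : Fin d → ℝ, ∫⁻ u, ENNReal.ofReal ((a ⬝ᵥ φ u) ^ 2) ∂P ≤
      ENNReal.ofReal (∑ l, a l ^ 2 * lam l)) :
    ∫⁻ x, ENNReal.ofReal (∑ i, ∑ j, offDiagonal (gramMatrix φ x) i j ^ 2)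
        ∂Measure.pi (fun _ : Fin n => P)
      ≤ ENNReal.ofReal (n ^ 2 * ∑ l, lam l ^ 2) := by
  have hφl : ∀ l, Measurable fun u => φ u l := fun l => (measurable_pi_apply l).comp hφ
  have hentry : ∀ i j, Measurable fun x : Fin n → U =>
      ENNReal.ofReal (offDiagonal (gramMatrix φ x) i j ^ 2) := by
    intro i j
    by_cases h : i = j
    · simp only [offDiagonal, of_apply, if_pos h, measurable_const]
    · simpa only [offDiagonal, of_apply, if_neg h] using
        ((measurable_gramMatrix hφ i j).pow_const 2).ennreal_ofReal
  have hone : ∀ l, ∫⁻ u, ENNReal.ofReal (φ u l ^ 2) ∂P ≤ ENNReal.ofReal (lam l) := by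
    intro l
    have := h2 (Pi.single l 1)
    simpa [Pi.single_apply, ite_pow] using this
  have hij : ∀ i j, ∫⁻ x, ENNReal.ofReal (offDiagonal (gramMatrix φ x) i j ^ 2)
      ∂Measure.pi (fun _ : Fin n => P) ≤ ENNReal.ofReal (∑ l, lam l ^ 2) := by
    intro i j
    by_cases h : i = j
    · simp [offDiagonal, h]
    rw [lintegral_pi_eq_lintegral_piecewise {i} (hentry i j)]
    have hj : j ∉ ({i} : Finset (Fin n)) := by simpa using Ne.symm h
    simp only [offDiagonal, of_apply, if_neg h, gramMatrix,
      piecewise_eq_of_mem _ _ _ (mem_singleton_self i), piecewise_eq_of_notMem _ _ _ hj]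
    calc _ ≤ ∫⁻ x, ∑ l, ENNReal.ofReal (lam l) * ENNReal.ofReal (φ (x j) l ^ 2)
          ∂Measure.pi (fun _ : Fin n => P) := by
          refine lintegral_mono fun x => ?_
          simp only [← ENNReal.ofReal_mul (hlam _)]
          rw [← ENNReal.ofReal_sum_of_nonneg fun l _ => mul_nonneg (hlam l) (sq_nonneg _)]
          refine le_trans (le_of_eq ?_) ((h2 (φ (x j))).trans (le_of_eq ?_))
          · rw [← (measurePreserving_eval (fun _ : Fin n => P) i).lintegral_comp]
            · simp [dotProduct_comm]
            · simp only [dotProduct]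
              fun_prop
          · simp only [mul_comm]
      _ ≤ ∑ l, ENNReal.ofReal (lam l) * ENNReal.ofReal (lam l) := by
          have hm : ∀ l, Measurable fun x : Fin n → U => ENNReal.ofReal (φ (x j) l ^ 2) :=
            fun l => (((hφl l).comp (measurable_pi_apply j)).pow_const 2).ennreal_ofReal
          rw [lintegral_finsetSum _ fun l _ => (hm l).const_mul _]
          refine sum_le_sum fun l _ => ?_
          rw [lintegral_const_mul _ (hm l)]
          refine mul_le_mul_right (le_trans (le_of_eq ?_) (hone l)) _
          exact (measurePreserving_eval (fun _ : Fin n => P) j).lintegral_comp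
            (((hφl l).pow_const 2).ennreal_ofReal)
      _ = _ := by
          simp only [← ENNReal.ofReal_mul (hlam _), ← pow_two]
          rw [ENNReal.ofReal_sum_of_nonneg fun l _ => sq_nonneg _]
  have hS : 0 ≤ ∑ l, lam l ^ 2 := sum_nonneg fun l _ => sq_nonneg _
  have e : ∀ x : Fin n → U,
      ENNReal.ofReal (∑ i, ∑ j, offDiagonal (gramMatrix φ x) i j ^ 2)
        = ∑ i, ∑ j, ENNReal.ofReal (offDiagonal (gramMatrix φ x) i j ^ 2) := fun x =>
    ofReal_sum_sum_sq fun i j => offDiagonal (gramMatrix φ x) i j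
  simp only [e]
  rw [lintegral_finsetSum _ fun i _ => Finset.measurable_sum _ fun j _ => hentry i j]
  calc _ ≤ ∑ _i : Fin n, ∑ _j : Fin n, ENNReal.ofReal (∑ l, lam l ^ 2) := by
        refine sum_le_sum fun i _ => ?_
        rw [lintegral_finsetSum _ fun j _ => hentry i j]
        exact sum_le_sum fun j _ => hij i j
    _ = _ := by
        simp only [sum_const, card_univ, Fintype.card_fin, nsmul_eq_mul]
        rw [← ENNReal.ofReal_natCast, ← ENNReal.ofReal_mul (by positivity),
          ← ENNReal.ofReal_mul (by positivity)]
        congr 1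
        ring

theorem lintegral_matrixOpNorm_offDiagonal_sq_le {U : Type*} [MeasurableSpace U] {P : Measure U}
    [IsProbabilityMeasure P] {n d : ℕ} {φ : U → Fin d → ℝ} (hφ : Measurable φ) {lam : Fin d → ℝ}
    (hlam : ∀ l, 0 ≤ lam l)
    (h2 : ∀ a : Fin d → ℝ, ∫⁻ u, ENNReal.ofReal ((a ⬝ᵥ φ u) ^ 2) ∂P ≤
      ENNReal.ofReal (∑ l, a l ^ 2 * lam l)) :
    ∫⁻ x, ENNReal.ofReal (matrixOpNorm (offDiagonal (gramMatrix φ x)) ^ 2)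
        ∂Measure.pi (fun _ : Fin n => P)
      ≤ ENNReal.ofReal (n ^ 2 * ∑ l, lam l ^ 2) :=
  (lintegral_mono fun _ => ENNReal.ofReal_le_ofReal (matrixOpNorm_sq_le_frobenius _)).trans
    (lintegral_sum_offDiagonal_sq_le hφ hlam h2)

theorem lintegral_sum_feature_sq_le {U : Type*} [MeasurableSpace U] {P : Measure U}
    [IsProbabilityMeasure P] {n d : ℕ} {φ : U → Fin d → ℝ} (hφ : Measurable φ) {lam : Fin d → ℝ}
    (hlam : ∀ l, 0 ≤ lam l)
    (h2 : ∀ a : Fin d → ℝ, ∫⁻ u, ENNReal.ofReal ((a ⬝ᵥ φ u) ^ 2) ∂P ≤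
      ENNReal.ofReal (∑ l, a l ^ 2 * lam l)) :
    ∫⁻ x, ENNReal.ofReal (∑ k, ∑ l, φ (x k) l ^ 2) ∂Measure.pi (fun _ : Fin n => P)
      ≤ ENNReal.ofReal (n * ∑ l, lam l) := by
  have hm : ∀ l, Measurable fun u => ENNReal.ofReal (φ u l ^ 2) := fun l =>
    (((measurable_pi_apply l).comp hφ).pow_const 2).ennreal_ofReal
  have hm' : ∀ (k : Fin n) l, Measurable fun x : Fin n → U => ENNReal.ofReal (φ (x k) l ^ 2) :=
    fun k l => (hm l).comp (measurable_pi_apply k)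
  have hone : ∀ l, ∫⁻ u, ENNReal.ofReal (φ u l ^ 2) ∂P ≤ ENNReal.ofReal (lam l) := by
    intro l
    have := h2 (Pi.single l 1)
    simpa [Pi.single_apply, ite_pow] using this
  have e : ∀ x : Fin n → U, ENNReal.ofReal (∑ k, ∑ l, φ (x k) l ^ 2)
      = ∑ k, ∑ l, ENNReal.ofReal (φ (x k) l ^ 2) := fun x =>
    ofReal_sum_sum_sq fun k l => φ (x k) l
  simp only [e]
  rw [lintegral_finsetSum _ fun k _ => Finset.measurable_sum _ fun l _ => hm' k l]
  calc _ ≤ ∑ _k : Fin n, ∑ l, ENNReal.ofReal (lam l) := by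
        refine sum_le_sum fun k _ => ?_
        rw [lintegral_finsetSum _ fun l _ => hm' k l]
        refine sum_le_sum fun l _ => le_trans (le_of_eq ?_) (hone l)
        exact (measurePreserving_eval (fun _ : Fin n => P) k).lintegral_comp (hm l)
    _ = _ := by
        rw [sum_const, card_univ, Fintype.card_fin, nsmul_eq_mul,
          ← ENNReal.ofReal_sum_of_nonneg fun l _ => hlam l, ← ENNReal.ofReal_natCast,
          ← ENNReal.ofReal_mul (by positivity)]

/-! ### The off-diagonal part in the hypercontractive range -/

/-- The expected squared norm of a decoupled block, in terms of the expected norm `D` of the whole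
off-diagonal part; this is what makes the final estimate self-bounding. -/
theorem lintegral_decoupledBlock_sq_le {U : Type*} [MeasurableSpace U] {P : Measure U}
    [IsProbabilityMeasure P] {n s d : ℕ} (hn1 : 1 ≤ n) (hs : 1 ≤ s) (hn : n ≤ 3 ^ (s + 1))
    {φ : U → Fin d → ℝ} (hφ : Measurable φ) {lam : Fin d → ℝ} {L A t H D : ℝ}
    (hlam : ∀ l, 0 ≤ lam l) (hlamL : ∀ l, lam l ≤ L) (hL : 0 < L) (hA : 0 < A) (ht : 0 < t)
    (htr : ∑ l, lam l ≤ t) (hH0 : 0 ≤ H) (hD0 : 0 ≤ D)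
    (h2 : ∀ a : Fin d → ℝ, ∫⁻ u, ENNReal.ofReal ((a ⬝ᵥ φ u) ^ 2) ∂P ≤
      ENNReal.ofReal (∑ l, a l ^ 2 * lam l))
    (hHC : ∀ a : Fin d → ℝ, ∫⁻ u, ENNReal.ofReal ((a ⬝ᵥ φ u) ^ (2 * s)) ∂P ≤
      ENNReal.ofReal ((A * ∑ l, a l ^ 2 * lam l) ^ s))
    (hH : ∫⁻ x, ENNReal.ofReal (⨆ i : Fin n, ∑ l, φ (x i) l ^ 2)
      ∂Measure.pi (fun _ : Fin n => P) ≤ ENNReal.ofReal H)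
    (hD : ∫⁻ x, ENNReal.ofReal (matrixOpNorm (offDiagonal (gramMatrix φ x)))
      ∂Measure.pi (fun _ : Fin n => P) ≤ ENNReal.ofReal D) (T : Finset (Fin n)) :
    ∫⁻ x, ENNReal.ofReal (matrixOpNorm (decoupledBlock T (gramMatrix φ x)) ^ 2)
        ∂Measure.pi (fun _ : Fin n => P)
      ≤ ENNReal.ofReal (18 * n * L * (H + D) + (54 * s + 9) * (A * L) * ((n + 1) * t)) := by
  set π := Measure.pi (fun _ : Fin n => P) with hπ
  have hoff := (measurable_matrixOpNorm_offDiagonal (n := n) hφ).ennreal_ofReal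
  have hfeat : Measurable fun x : Fin n → U => ENNReal.ofReal (∑ k, ∑ l, φ (x k) l ^ 2) := by
    have hφl : ∀ l, Measurable fun u => φ u l := fun l => (measurable_pi_apply l).comp hφ
    fun_prop
  rw [hπ, lintegral_pi_eq_lintegral_piecewise T
    (((measurable_matrixOpNorm_decoupledBlock hφ T).pow_const 2).ennreal_ofReal), ← hπ]
  calc _ ≤ ∫⁻ x, ENNReal.ofReal (18 * (n * (L * matrixOpNorm (gramMatrix φ x))
          + 3 * s * (A * L * (∑ k, ∑ l, φ (x k) l ^ 2 + t)))
          + 9 * (A * L * (∑ k, ∑ l, φ (x k) l ^ 2 + t))) ∂π :=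
        lintegral_mono fun x =>
          lintegral_decoupledBlock_conditional_le hn1 hs hn hφ hlam hlamL hL hA ht h2 hHC T x
    _ ≤ ∫⁻ x, (ENNReal.ofReal (18 * n * L) * ENNReal.ofReal (⨆ i : Fin n, ∑ l, φ (x i) l ^ 2)
          + (ENNReal.ofReal (18 * n * L)
              * ENNReal.ofReal (matrixOpNorm (offDiagonal (gramMatrix φ x)))
          + ENNReal.ofReal ((54 * s + 9) * (A * L))
              * (ENNReal.ofReal (∑ k, ∑ l, φ (x k) l ^ 2) + ENNReal.ofReal t))) ∂π := by
        refine lintegral_mono fun x => ?_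
        have h0 : 0 ≤ ⨆ i : Fin n, ∑ l, φ (x i) l ^ 2 :=
          Real.iSup_nonneg fun i => sum_nonneg fun l _ => sq_nonneg _
        have h1 := matrixOpNorm_gramMatrix_le φ x h0
          (fun i => le_ciSup (f := fun i : Fin n => ∑ l, φ (x i) l ^ 2)
            (Set.finite_range _).bddAbove i)
        have h3 : 0 ≤ ∑ k, ∑ l, φ (x k) l ^ 2 :=
          sum_nonneg fun k _ => sum_nonneg fun l _ => sq_nonneg _
        have h4 := matrixOpNorm_nonneg (offDiagonal (gramMatrix φ x))
        rw [← ENNReal.ofReal_add h3 ht.le, ← ENNReal.ofReal_mul (by positivity),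
          ← ENNReal.ofReal_mul (by positivity), ← ENNReal.ofReal_mul (by positivity),
          ← ENNReal.ofReal_add (by positivity) (by positivity),
          ← ENNReal.ofReal_add (by positivity) (by positivity)]
        refine ENNReal.ofReal_le_ofReal ?_
        have h5 := mul_le_mul_of_nonneg_left h1 (show (0 : ℝ) ≤ 18 * n * L by positivity)
        linarith
    _ ≤ ENNReal.ofReal (18 * n * L) * ENNReal.ofReal H + (ENNReal.ofReal (18 * n * L)
          * ENNReal.ofReal D + ENNReal.ofReal ((54 * s + 9) * (A * L))
            * (ENNReal.ofReal (n * ∑ l, lam l) + ENNReal.ofReal t)) := by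
        have hm1 : Measurable fun x : Fin n → U => ENNReal.ofReal (18 * n * L)
              * ENNReal.ofReal (matrixOpNorm (offDiagonal (gramMatrix φ x))) := hoff.const_mul _
        have hm2 : Measurable fun x : Fin n → U => ENNReal.ofReal ((54 * s + 9) * (A * L))
            * (ENNReal.ofReal (∑ k, ∑ l, φ (x k) l ^ 2) + ENNReal.ofReal t) :=
          (hfeat.add_const _).const_mul _
        have hm3 : Measurable fun x : Fin n → U => ENNReal.ofReal (18 * n * L)
              * ENNReal.ofReal (matrixOpNorm (offDiagonal (gramMatrix φ x)))
            + ENNReal.ofReal ((54 * s + 9) * (A * L))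
              * (ENNReal.ofReal (∑ k, ∑ l, φ (x k) l ^ 2) + ENNReal.ofReal t) := hm1.add hm2
        rw [lintegral_add_right _ hm3, lintegral_add_right _ hm2,
          lintegral_const_mul' _ _ ENNReal.ofReal_ne_top,
          lintegral_const_mul' _ _ ENNReal.ofReal_ne_top,
          lintegral_const_mul' _ _ ENNReal.ofReal_ne_top, lintegral_add_right _ measurable_const,
          lintegral_const, measure_univ, mul_one]
        gcongr
        exact lintegral_sum_feature_sq_le hφ hlam h2
    _ ≤ _ := by
        have h3 : 0 ≤ ∑ l, lam l := sum_nonneg fun l _ => hlam l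
        rw [← ENNReal.ofReal_add (by positivity) ht.le, ← ENNReal.ofReal_mul (by positivity),
          ← ENNReal.ofReal_mul (by positivity), ← ENNReal.ofReal_mul (by positivity),
          ← ENNReal.ofReal_add (by positivity) (by positivity),
          ← ENNReal.ofReal_add (by positivity) (by positivity)]
        refine ENNReal.ofReal_le_ofReal ?_
        have h5 : (n : ℝ) * ∑ l, lam l + t ≤ (n + 1) * t := by
          have := mul_le_mul_of_nonneg_left htr (Nat.cast_nonneg (α := ℝ) n)
          linarith
        have h6 := mul_le_mul_of_nonneg_left h5
          (show (0 : ℝ) ≤ (54 * s + 9) * (A * L) by positivity)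
        linarith

/-- The elementary inequality that solves the self-bounding estimate for `D`. -/
theorem self_bounding_solve {n s : ℕ} (hn1 : 1 ≤ n) (hs : 1 ≤ s) {L A t α τ D : ℝ} (hL : 0 < L)
    (hA : 1 ≤ A) (ht : 0 < t) (hα : 0 ≤ α) (hτ0 : 0 < τ) (hτ : τ ^ 2 = n * L * t)
    (hnL : n * L ≤ t) (hsA : (s : ℝ) ≤ 4 * A) (hD0 : 0 ≤ D)
    (h : D ≤ 4 * (72 * τ * (α + A) / 2 +
      (18 * n * L * (t + α * τ + D) + (54 * s + 9) * (A * L) * ((n + 1) * t))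
        / (2 * (72 * τ * (α + A))))) :
    D ≤ 400 * (α + A) * τ := by
  have hn1' : (1 : ℝ) ≤ n := by exact_mod_cast hn1
  have hs' : (1 : ℝ) ≤ s := by exact_mod_cast hs
  have hnL0 : 0 < n * L := by positivity
  have hnLτ : n * L ≤ τ := by
    refine le_of_sq_le_sq ?_ hτ0.le
    rw [hτ, pow_two]
    exact mul_le_mul_of_nonneg_left hnL hnL0.le
  set B : ℝ := α + A with hB
  have hB1 : 1 ≤ B := by linarith
  have hAB : A ≤ B := by linarith
  have hQ1 : 18 * n * L * (t + α * τ + D) ≤ 18 * τ ^ 2 * B + 18 * τ * D := by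
    have e1 : n * L * (α * τ) ≤ τ * (α * τ) := mul_le_mul_of_nonneg_right hnLτ (by positivity)
    have e2 : n * L * D ≤ τ * D := mul_le_mul_of_nonneg_right hnLτ hD0
    have e3 : τ ^ 2 * 1 ≤ τ ^ 2 * A := mul_le_mul_of_nonneg_left hA (by positivity)
    rw [hB]
    nlinarith
  have hQ2 : (54 * s + 9) * (A * L) * ((n + 1) * t) ≤ 504 * B ^ 2 * τ ^ 2 := by
    have e1 : (54 * (s : ℝ) + 9) ≤ 252 * A := by linarith
    have e2 : L * ((n + 1) * t) ≤ 2 * τ ^ 2 := by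
      rw [hτ]
      nlinarith [mul_le_mul_of_nonneg_right hn1' (show 0 ≤ L * t by positivity)]
    calc (54 * s + 9) * (A * L) * ((n + 1) * t)
        = ((54 * s + 9) * A) * (L * ((n + 1) * t)) := by ring
      _ ≤ (252 * A * A) * (2 * τ ^ 2) :=
          mul_le_mul (mul_le_mul_of_nonneg_right e1 (by linarith)) e2 (by positivity)
            (by positivity)
      _ ≤ (252 * B * B) * (2 * τ ^ 2) := by gcongr
      _ = _ := by ring
  have h2 : D ≤ 4 * (72 * τ * B / 2 + (18 * τ ^ 2 * B + 18 * τ * D + 504 * B ^ 2 * τ ^ 2)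
        / (2 * (72 * τ * B))) := by
    refine h.trans ?_
    gcongr
  have e : 4 * (72 * τ * B / 2 + (18 * τ ^ 2 * B + 18 * τ * D + 504 * B ^ 2 * τ ^ 2)
        / (2 * (72 * τ * B))) = 144 * τ * B + τ / 2 + D / B / 2 + 14 * B * τ := by
    have : B ≠ 0 := by positivity
    field_simp
    ring
  rw [e] at h2
  have h3 : D / B ≤ D := div_le_self hD0 hB1
  have h4 : τ * 1 ≤ τ * B := mul_le_mul_of_nonneg_left hB1 hτ0.le
  nlinarith

/-- The off-diagonal part of the Gram matrix in the range `s ≤ 4 A`. -/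
theorem lintegral_offDiagonal_le {U : Type*} [MeasurableSpace U] {P : Measure U}
    [IsProbabilityMeasure P] {n s d : ℕ} (hn1 : 1 ≤ n) (hs : 1 ≤ s) (hn : n ≤ 3 ^ (s + 1))
    {φ : U → Fin d → ℝ} (hφ : Measurable φ) {lam : Fin d → ℝ} {L A t α τ : ℝ}
    (hlam : ∀ l, 0 ≤ lam l) (hlamL : ∀ l, lam l ≤ L) (hL : 0 < L) (hA : 1 ≤ A) (ht : 0 < t)
    (htr : ∑ l, lam l ≤ t) (hα : 0 ≤ α) (hτ0 : 0 < τ) (hτ : τ ^ 2 = n * L * t)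
    (hnL : n * L ≤ t) (hsA : (s : ℝ) ≤ 4 * A)
    (h2 : ∀ a : Fin d → ℝ, ∫⁻ u, ENNReal.ofReal ((a ⬝ᵥ φ u) ^ 2) ∂P ≤
      ENNReal.ofReal (∑ l, a l ^ 2 * lam l))
    (hHC : ∀ a : Fin d → ℝ, ∫⁻ u, ENNReal.ofReal ((a ⬝ᵥ φ u) ^ (2 * s)) ∂P ≤
      ENNReal.ofReal ((A * ∑ l, a l ^ 2 * lam l) ^ s))
    (hH : ∫⁻ x, ENNReal.ofReal (⨆ i : Fin n, ∑ l, φ (x i) l ^ 2)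
      ∂Measure.pi (fun _ : Fin n => P) ≤ ENNReal.ofReal (t + α * τ)) :
    ∫⁻ x, ENNReal.ofReal (matrixOpNorm (offDiagonal (gramMatrix φ x)))
      ∂Measure.pi (fun _ : Fin n => P) ≤ ENNReal.ofReal (400 * (α + A) * τ) := by
  have hA0 : 0 < A := by linarith
  set π := Measure.pi (fun _ : Fin n => P) with hπ
  set I := ∫⁻ x, ENNReal.ofReal (matrixOpNorm (offDiagonal (gramMatrix φ x))) ∂π with hI
  have hfin : I ≠ ⊤ := by
    have := lintegral_ofReal_le_of_sq one_pos
      (lintegral_matrixOpNorm_offDiagonal_sq_le (n := n) hφ hlam h2)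
      (by have : 0 ≤ ∑ l, lam l ^ 2 := sum_nonneg fun l _ => sq_nonneg _
          positivity)
    exact ne_top_of_le_ne_top ENNReal.ofReal_ne_top this
  set D := I.toReal with hDdef
  have hD0 : 0 ≤ D := ENNReal.toReal_nonneg
  have hID : I = ENNReal.ofReal D := (ENNReal.ofReal_toReal hfin).symm
  rw [hID]
  refine ENNReal.ofReal_le_ofReal (self_bounding_solve hn1 hs hL hA ht hα hτ0 hτ hnL hsA hD0 ?_)
  -- The parameter `k` is of the order of the target; with `72`, the term `D` on the right-hand side
  -- of the resulting inequality gets a coefficient at most `1 / 2`.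
  set k : ℝ := 72 * τ * (α + A) with hk
  have hk0 : 0 < k := by positivity
  set q : ℝ := 18 * n * L * (t + α * τ + D) + (54 * s + 9) * (A * L) * ((n + 1) * t) with hq
  have hq0 : 0 ≤ q := by positivity
  have hblock : ∀ T : Finset (Fin n),
      ∫⁻ x, ENNReal.ofReal (matrixOpNorm (decoupledBlock T (gramMatrix φ x))) ∂π
        ≤ ENNReal.ofReal (k / 2 + q / (2 * k)) := fun T =>
    lintegral_ofReal_le_of_sq hk0 (lintegral_decoupledBlock_sq_le hn1 hs hn hφ hlam hlamL hL hA0 ht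
      htr (by positivity) hD0 h2 hHC hH hID.le T) hq0
  have hmain : I ≤ ENNReal.ofReal (4 * (k / 2 + q / (2 * k))) := by
    calc I ≤ ∫⁻ x, ENNReal.ofReal (4 / 2 ^ n) * ∑ T : Finset (Fin n),
          ENNReal.ofReal (matrixOpNorm (decoupledBlock T (gramMatrix φ x))) ∂π := by
          refine lintegral_mono fun x => ?_
          rw [← ENNReal.ofReal_sum_of_nonneg fun T _ => matrixOpNorm_nonneg _,
            ← ENNReal.ofReal_mul (by positivity)]
          exact ENNReal.ofReal_le_ofReal (matrixOpNorm_offDiagonal_le_decoupled _)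
      _ ≤ ENNReal.ofReal (4 / 2 ^ n) * ∑ _T : Finset (Fin n),
          ENNReal.ofReal (k / 2 + q / (2 * k)) := by
          rw [lintegral_const_mul' _ _ ENNReal.ofReal_ne_top, lintegral_finsetSum _ fun T _ =>
            (measurable_matrixOpNorm_decoupledBlock hφ T).ennreal_ofReal]
          exact mul_le_mul_right (sum_le_sum fun T _ => hblock T) _
      _ = _ := by
          rw [sum_const, card_univ, Fintype.card_finset, Fintype.card_fin, nsmul_eq_mul,
            ← ENNReal.ofReal_natCast, ← ENNReal.ofReal_mul (by positivity),
            ← ENNReal.ofReal_mul (by positivity)]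
          congr 1
          push_cast
          field_simp
  rw [hID] at hmain
  exact (ENNReal.ofReal_le_ofReal_iff (by positivity)).1 hmain

open Filter Topology

/-! ### Kernels given by an infinite orthogonal feature map -/

/-- Orthogonal square-integrable features `φ j` with squared norms `lam j`. -/
structure IsOrthogonalFeature {U : Type*} [MeasurableSpace U] (P : Measure U) (φ : ℕ → U → ℝ)
    (lam : ℕ → ℝ) : Prop where
  measurable : ∀ j, Measurable (φ j)
  memLp : ∀ j, MemLp (φ j) 2 P
  orthogonal : ∀ i j, ∫ u, φ i u * φ j u ∂P = if i = j then lam i else 0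
  antitone : Antitone lam
  summable : Summable lam

/-- The matrix of the kernel `∑_{l ≥ k} φ_l(x) φ_l(y)` on a sample. -/
noncomputable def featureKernelMatrix {U : Type*} {n : ℕ} (φ : ℕ → U → ℝ) (k : ℕ)
    (x : Fin n → U) : Matrix (Fin n) (Fin n) ℝ :=
  Matrix.of fun i j => ∑' l, φ (k + l) (x i) * φ (k + l) (x j)

/-- The `d` features from number `k` on, as a feature map into `ℝ ^ d`. -/
def featureBlock {U : Type*} (φ : ℕ → U → ℝ) (k d : ℕ) (u : U) (l : Fin d) : ℝ :=
  φ (k + l) u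

namespace IsOrthogonalFeature

variable {U : Type*} [MeasurableSpace U] {P : Measure U} {φ : ℕ → U → ℝ} {lam : ℕ → ℝ}

theorem nonneg (h : IsOrthogonalFeature P φ lam) (j : ℕ) : 0 ≤ lam j := by
  have := h.orthogonal j j
  rw [if_pos rfl] at this
  rw [← this]
  exact integral_nonneg fun u => mul_self_nonneg _

theorem measurable_featureBlock (h : IsOrthogonalFeature P φ lam) (k d : ℕ) :
    Measurable (featureBlock φ k d) :=
  measurable_pi_lambda _ fun l => h.measurable (k + l)

theorem integrable_mul (h : IsOrthogonalFeature P φ lam) (i j : ℕ) :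
    Integrable (fun u => φ i u * φ j u) P :=
  (h.memLp i).integrable_mul (h.memLp j)

theorem lintegral_sq (h : IsOrthogonalFeature P φ lam) (j : ℕ) :
    ∫⁻ u, ENNReal.ofReal (φ j u ^ 2) ∂P = ENNReal.ofReal (lam j) := by
  have h1 := h.orthogonal j j
  rw [if_pos rfl] at h1
  simp only [pow_two]
  rw [← h1, ofReal_integral_eq_lintegral_ofReal (h.integrable_mul j j)
    (ae_of_all _ fun u => mul_self_nonneg _)]

theorem lintegral_dotProduct_sq (h : IsOrthogonalFeature P φ lam) (k : ℕ) {d : ℕ}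
    (a : Fin d → ℝ) :
    ∫⁻ u, ENNReal.ofReal ((a ⬝ᵥ featureBlock φ k d u) ^ 2) ∂P
      = ENNReal.ofReal (∑ l, a l ^ 2 * lam (k + l)) := by
  have e : ∀ u, (a ⬝ᵥ featureBlock φ k d u) ^ 2
      = ∑ i, ∑ j, (a i * a j) * (φ (k + i) u * φ (k + j) u) := by
    intro u
    rw [pow_two, dotProduct, sum_mul_sum]
    exact sum_congr rfl fun i _ => sum_congr rfl fun j _ => by
      simp only [featureBlock]; ring
  have hi : ∀ i j : Fin d, Integrable
      (fun u => (a i * a j) * (φ (k + i) u * φ (k + j) u)) P := fun i j =>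
    (h.integrable_mul _ _).const_mul _
  have hint : Integrable (fun u => (a ⬝ᵥ featureBlock φ k d u) ^ 2) P := by
    simp only [e]
    exact integrable_finsetSum _ fun i _ => integrable_finsetSum _ fun j _ => hi i j
  rw [← ofReal_integral_eq_lintegral_ofReal hint (ae_of_all _ fun u => sq_nonneg _)]
  congr 1
  simp only [e]
  rw [integral_finsetSum _ fun i _ => integrable_finsetSum _ fun j _ => hi i j]
  refine sum_congr rfl fun i _ => ?_
  rw [integral_finsetSum _ fun j _ => hi i j]
  have : ∀ j : Fin d, ∫ u, (a i * a j) * (φ (k + i) u * φ (k + j) u) ∂P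
      = if i = j then a i ^ 2 * lam (k + i) else 0 := by
    intro j
    rw [integral_const_mul, h.orthogonal]
    by_cases hij : i = j
    · subst hij
      simp [pow_two]
    · have : ¬ (k + (i : ℕ) = k + (j : ℕ)) := fun h' => hij (Fin.ext (by omega))
      rw [if_neg hij, if_neg this, mul_zero]
  simp [this]

theorem ae_summable (h : IsOrthogonalFeature P φ lam) :
    ∀ᵐ u ∂P, Summable fun j => φ j u ^ 2 := by
  have hm : ∀ j, Measurable fun u => ENNReal.ofReal (φ j u ^ 2) := fun j =>
    ((h.measurable j).pow_const 2).ennreal_ofReal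
  have hfin : ∫⁻ u, ∑' j, ENNReal.ofReal (φ j u ^ 2) ∂P ≠ ⊤ := by
    rw [lintegral_tsum fun j => (hm j).aemeasurable]
    simp only [h.lintegral_sq]
    rw [← ENNReal.ofReal_tsum_of_nonneg h.nonneg h.summable]
    exact ENNReal.ofReal_ne_top
  filter_upwards [ae_lt_top (Measurable.tsum hm) hfin] with u hu
  have := ENNReal.summable_toReal hu.ne
  simpa [ENNReal.toReal_ofReal (sq_nonneg _)] using this

theorem ae_summable_pi {n : ℕ} [IsProbabilityMeasure P] (h : IsOrthogonalFeature P φ lam) :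
    ∀ᵐ x ∂Measure.pi (fun _ : Fin n => P), ∀ i, Summable fun j => φ j (x i) ^ 2 :=
  ae_all_iff.2 fun i =>
    (measurePreserving_eval (fun _ : Fin n => P) i).quasiMeasurePreserving.ae h.ae_summable

theorem measurable_diagonal (h : IsOrthogonalFeature P φ lam) :
    Measurable fun u => ∑' j, φ j u ^ 2 := by
  exact Measurable.tsum fun j => (h.measurable j).pow_const 2

theorem integrable_sq (h : IsOrthogonalFeature P φ lam) (j : ℕ) :
    Integrable (fun u => φ j u ^ 2) P := by
  simpa only [pow_two] using h.integrable_mul j j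

theorem integral_sq (h : IsOrthogonalFeature P φ lam) (j : ℕ) :
    ∫ u, φ j u ^ 2 ∂P = lam j := by
  simpa only [pow_two, if_true] using h.orthogonal j j

theorem integral_diagonal (h : IsOrthogonalFeature P φ lam) :
    ∫ u, ∑' j, φ j u ^ 2 ∂P = ∑' j, lam j := by
  have := hasSum_integral_of_summable_integral_norm (F := fun j u => φ j u ^ 2) (μ := P)
    (fun j => h.integrable_sq j)
    (by simpa [h.integral_sq] using h.summable)
  simp only [h.integral_sq] at this
  exact this.tsum_eq.symm

theorem integrable_diagonal (h : IsOrthogonalFeature P φ lam) :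
    Integrable (fun u => ∑' j, φ j u ^ 2) P := by
  refine ⟨h.measurable_diagonal.aestronglyMeasurable, ?_⟩
  rw [hasFiniteIntegral_iff_ofReal (ae_of_all _ fun u => tsum_nonneg fun j => sq_nonneg _)]
  calc ∫⁻ u, ENNReal.ofReal (∑' j, φ j u ^ 2) ∂P = ∫⁻ u, ∑' j, ENNReal.ofReal (φ j u ^ 2) ∂P :=
        lintegral_congr_ae (by
          filter_upwards [h.ae_summable] with u hu
          exact ENNReal.ofReal_tsum_of_nonneg (fun j => sq_nonneg _) hu)
    _ = ENNReal.ofReal (∑' j, lam j) := by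
        rw [lintegral_tsum fun j => ((h.measurable j).pow_const 2).ennreal_ofReal.aemeasurable]
        simp only [h.lintegral_sq]
        rw [← ENNReal.ofReal_tsum_of_nonneg h.nonneg h.summable]
    _ < ⊤ := ENNReal.ofReal_lt_top

end IsOrthogonalFeature

theorem summable_mul_of_sq {f g : ℕ → ℝ} (hf : Summable fun j => f j ^ 2)
    (hg : Summable fun j => g j ^ 2) : Summable fun j => f j * g j := by
  refine Summable.of_norm_bounded (hf.add hg) fun j => ?_
  rw [Real.norm_eq_abs, abs_le]
  constructor <;> nlinarith [sq_nonneg (f j + g j), sq_nonneg (f j - g j)]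

theorem summable_featureKernel {U : Type*} {φ : ℕ → U → ℝ} {x y : U}
    (hx : Summable fun j => φ j x ^ 2) (hy : Summable fun j => φ j y ^ 2) (k : ℕ) :
    Summable fun l => φ (k + l) x * φ (k + l) y := by
  have := (summable_nat_add_iff k).2 (summable_mul_of_sq hx hy)
  simpa only [add_comm] using this

theorem gramMatrix_featureBlock_apply {U : Type*} {n : ℕ} (φ : ℕ → U → ℝ) (k d : ℕ)
    (x : Fin n → U) (i j : Fin n) :
    gramMatrix (featureBlock φ k d) x i j = ∑ l ∈ range d, φ (k + l) (x i) * φ (k + l) (x j) := by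
  rw [sum_range]
  rfl

theorem tendsto_gramMatrix_featureBlock {U : Type*} {n : ℕ} {φ : ℕ → U → ℝ} {x : Fin n → U}
    (hx : ∀ i, Summable fun j => φ j (x i) ^ 2) (k : ℕ) (i j : Fin n) :
    Tendsto (fun N => gramMatrix (featureBlock φ k N) x i j) atTop
      (𝓝 (featureKernelMatrix φ k x i j)) := by
  simp only [gramMatrix_featureBlock_apply]
  exact (summable_featureKernel (hx i) (hx j) k).hasSum.tendsto_sum_nat

/-- Beyond the index `k` no moment assumption is needed: the Frobenius norm suffices. -/
theorem IsOrthogonalFeature.lintegral_offDiagonal_tail_sq_le {U : Type*} [MeasurableSpace U]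
    {P : Measure U} [IsProbabilityMeasure P] {φ : ℕ → U → ℝ} {lam : ℕ → ℝ}
    (h : IsOrthogonalFeature P φ lam) (n k : ℕ) :
    ∫⁻ x, ENNReal.ofReal (matrixOpNorm (offDiagonal (featureKernelMatrix φ k x)) ^ 2)
        ∂Measure.pi (fun _ : Fin n => P)
      ≤ ENNReal.ofReal (n ^ 2 * (lam k * ∑' j, lam j)) := by
  set π := Measure.pi (fun _ : Fin n => P) with hπ
  have hent : ∀ {x : Fin n → U}, (∀ i, Summable fun j => φ j (x i) ^ 2) → ∀ i j,
      Tendsto (fun N => offDiagonal (gramMatrix (featureBlock φ k N) x) i j) atTop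
        (𝓝 (offDiagonal (featureKernelMatrix φ k x) i j)) := by
    intro x hx i j
    by_cases hij : i = j
    · simp only [offDiagonal, of_apply, if_pos hij, tendsto_const_nhds]
    · simpa only [offDiagonal, of_apply, if_neg hij] using
        tendsto_gramMatrix_featureBlock hx k i j
  have hmeas : ∀ N, Measurable fun x : Fin n → U => ENNReal.ofReal
      (∑ i, ∑ j, offDiagonal (gramMatrix (featureBlock φ k N) x) i j ^ 2) := by
    intro N
    refine (Finset.measurable_sum _ fun i _ => Finset.measurable_sum _ fun j _ =>
      Measurable.pow_const ?_ 2).ennreal_ofReal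
    by_cases hij : i = j
    · simp only [offDiagonal, of_apply, if_pos hij, measurable_const]
    · simpa only [offDiagonal, of_apply, if_neg hij] using
        measurable_gramMatrix (h.measurable_featureBlock k N) i j
  have hbound : ∀ N, ∫⁻ x, ENNReal.ofReal
      (∑ i, ∑ j, offDiagonal (gramMatrix (featureBlock φ k N) x) i j ^ 2) ∂π
      ≤ ENNReal.ofReal (n ^ 2 * (lam k * ∑' j, lam j)) := by
    intro N
    refine (lintegral_sum_offDiagonal_sq_le (lam := fun l : Fin N => lam (k + l))
      (h.measurable_featureBlock k N) (fun l => h.nonneg _)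
      (fun a => (h.lintegral_dotProduct_sq k a).le)).trans (ENNReal.ofReal_le_ofReal ?_)
    refine mul_le_mul_of_nonneg_left ?_ (by positivity)
    have hsum : ∑ l : Fin N, lam (k + l) ≤ ∑' j, lam j := by
      have h1 : ∑ l : Fin N, lam (k + l) = ∑ j ∈ (range N).map (addLeftEmbedding k), lam j := by
        rw [sum_map, sum_range]
        rfl
      rw [h1]
      exact h.summable.sum_le_tsum _ fun j _ => h.nonneg j
    calc ∑ l : Fin N, lam (k + l) ^ 2 ≤ ∑ l : Fin N, lam k * lam (k + l) :=
          sum_le_sum fun l _ => by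
            rw [pow_two]
            exact mul_le_mul_of_nonneg_right (h.antitone (Nat.le_add_right _ _)) (h.nonneg _)
      _ ≤ _ := by
          rw [← mul_sum]
          exact mul_le_mul_of_nonneg_left hsum (h.nonneg k)
  calc _ ≤ ∫⁻ x, liminf (fun N => ENNReal.ofReal
          (∑ i, ∑ j, offDiagonal (gramMatrix (featureBlock φ k N) x) i j ^ 2)) atTop ∂π := by
        refine lintegral_mono_ae ?_
        filter_upwards [h.ae_summable_pi (n := n)] with x hx
        have ht : Tendsto (fun N => ENNReal.ofReal
            (∑ i, ∑ j, offDiagonal (gramMatrix (featureBlock φ k N) x) i j ^ 2)) atTop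
            (𝓝 (ENNReal.ofReal (∑ i, ∑ j, offDiagonal (featureKernelMatrix φ k x) i j ^ 2))) :=
          ENNReal.tendsto_ofReal (tendsto_finsetSum _ fun i _ => tendsto_finsetSum _ fun j _ =>
            (hent hx i j).pow 2)
        rw [ht.liminf_eq]
        exact ENNReal.ofReal_le_ofReal (matrixOpNorm_sq_le_frobenius _)
    _ ≤ liminf (fun N => ∫⁻ x, ENNReal.ofReal
          (∑ i, ∑ j, offDiagonal (gramMatrix (featureBlock φ k N) x) i j ^ 2) ∂π) atTop :=
        lintegral_liminf_le hmeas
    _ ≤ liminf (fun _ : ℕ => ENNReal.ofReal (n ^ 2 * (lam k * ∑' j, lam j))) atTop :=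
        liminf_le_liminf (Eventually.of_forall hbound)
    _ = _ := liminf_const _

/-- Either the moment order `s` or the dimension `d` is controlled by the hypercontractivity
constant `A`. -/
theorem IsOrthogonalFeature.order_le_or_dimension_le {U : Type*} [MeasurableSpace U]
    {P : Measure U} [IsProbabilityMeasure P] {φ : ℕ → U → ℝ} {lam : ℕ → ℝ}
    (h : IsOrthogonalFeature P φ lam) {d s : ℕ} (hs : 1 ≤ s) {A : ℝ} (hA : 0 ≤ A)
    (hpos : ∀ l < d, 0 < lam l)
    (hHC : ∀ a : Fin d → ℝ, ∫⁻ u, ENNReal.ofReal ((a ⬝ᵥ featureBlock φ 0 d u) ^ (2 * s)) ∂P ≤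
      ENNReal.ofReal ((A * ∑ l, a l ^ 2 * lam l) ^ s)) :
    (s : ℝ) ≤ 4 * A ∨ (d : ℝ) ≤ 4 * A := by
  set D := min d s with hD
  have hDd : D ≤ d := min_le_left _ _
  set v : U → Fin D → ℝ := fun u l => φ l u / √(lam l) with hv
  have hvm : Measurable v := measurable_pi_lambda _ fun l => (h.measurable l).div_const _
  have hposD : ∀ l : Fin D, 0 < lam l := fun l => hpos l (lt_of_lt_of_le l.2 hDd)
  have hHCv : ∀ a : Fin D → ℝ, ∫⁻ u, ENNReal.ofReal ((a ⬝ᵥ v u) ^ (2 * s)) ∂P ≤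
      ENNReal.ofReal (A ^ s * (∑ l, a l ^ 2) ^ s) := by
    intro a
    set b : Fin d → ℝ := fun l => if hl : (l : ℕ) < D then a ⟨l, hl⟩ / √(lam l) else 0 with hb
    have hsum : ∀ F : Fin d → ℝ, (∀ l : Fin d, ¬ (l : ℕ) < D → F l = 0) →
        ∑ l, F l = ∑ l : Fin D, F (Fin.castLE hDd l) := by
      intro F hF
      change _ = ∑ l : Fin D, F (Fin.castLEEmb hDd l)
      rw [← sum_map univ (Fin.castLEEmb hDd) F]
      symm
      refine sum_subset (subset_univ _) fun l _ hl => hF l fun hlD => hl ?_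
      exact mem_map.2 ⟨⟨l, hlD⟩, mem_univ _, rfl⟩
    have e1 : ∀ u, a ⬝ᵥ v u = b ⬝ᵥ featureBlock φ 0 d u := by
      intro u
      rw [dotProduct, dotProduct, hsum]
      · refine sum_congr rfl fun l _ => ?_
        simp only [hb, hv, featureBlock, Fin.val_castLE, l.2, dif_pos, zero_add]
        ring
      · intro l hl
        simp only [hb, dif_neg hl, zero_mul]
    have e2 : ∑ l, b l ^ 2 * lam l = ∑ l, a l ^ 2 := by
      rw [hsum]
      · refine sum_congr rfl fun l _ => ?_
        simp only [hb, Fin.val_castLE, l.2, dif_pos]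
        rw [div_pow, Real.sq_sqrt (hposD l).le, div_mul_cancel₀ _ (hposD l).ne']
      · intro l hl
        simp only [hb, dif_neg hl, zero_pow two_ne_zero, zero_mul]
    simp only [e1]
    refine (hHC b).trans (le_of_eq ?_)
    rw [e2, mul_pow]
  have hint1 : ∀ l, Integrable (fun u => (v u l ^ 2) ^ s) P := by
    intro l
    refine ⟨(((measurable_pi_apply l).comp hvm).pow_const 2 |>.pow_const s).aestronglyMeasurable,
      ?_⟩
    rw [hasFiniteIntegral_iff_ofReal (ae_of_all _ fun u => by positivity)]
    refine lt_of_le_of_lt ?_ (ENNReal.ofReal_lt_top (r := A ^ s * (∑ i, Pi.single l 1 i ^ 2) ^ s))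
    refine le_trans (le_of_eq ?_) (hHCv (Pi.single l 1))
    simp [pow_mul]
  have hint : Integrable (fun u => (∑ l, v u l ^ 2) ^ s) P := by
    obtain ⟨q, rfl⟩ : ∃ q, s = q + 1 := ⟨s - 1, by omega⟩
    refine ((integrable_finsetSum univ fun l _ => hint1 l).const_mul ((D : ℝ) ^ q)).mono' ?_
      (ae_of_all _ fun u => ?_)
    · have : ∀ l, Measurable fun u => v u l := fun l => (measurable_pi_apply l).comp hvm
      exact Measurable.aestronglyMeasurable (by fun_prop)
    · rw [Real.norm_eq_abs, abs_of_nonneg (pow_nonneg (sum_nonneg fun l _ => sq_nonneg _) _)]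
      rcases Nat.eq_zero_or_pos D with h0 | h0
      · have : IsEmpty (Fin D) := by rw [h0]; infer_instance
        simp
      · have := pow_sum_div_card_le_sum_pow (s := (univ : Finset (Fin D)))
          (f := fun l => v u l ^ 2) (fun l _ => sq_nonneg _) q
        rw [card_univ, Fintype.card_fin, div_le_iff₀ (by positivity)] at this
        linarith
  have hnorm : ∀ l, ∫ u, v u l ^ 2 ∂P = 1 := by
    intro l
    simp only [hv, div_pow, Real.sq_sqrt (hposD l).le]
    rw [integral_div, h.integral_sq, div_self (hposD l).ne']
  have key := dimension_le_of_moment_bound (min_le_right d s) hvm hnorm hint hA fun a => by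
    rw [integral_eq_lintegral_of_nonneg_ae (ae_of_all _ fun u => by
      rw [pow_mul]; positivity)]
    · exact ENNReal.toReal_le_of_le_ofReal (by positivity) (hHCv a)
    · have : ∀ l, Measurable fun u => v u l := fun l => (measurable_pi_apply l).comp hvm
      unfold dotProduct
      exact Measurable.aestronglyMeasurable (by fun_prop)
  rcases min_cases d s with ⟨h1, _⟩ | ⟨h1, _⟩
  · right; rwa [h1] at key
  · left; rwa [h1] at key

/-! ### The empirical kernel matrix -/

theorem matrixOpNorm_sub_smul_one_le {n : ℕ} (M : Matrix (Fin n) (Fin n) ℝ) (t : ℝ) :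
    matrixOpNorm (M - t • (1 : Matrix (Fin n) (Fin n) ℝ))
      ≤ (⨆ i, |M i i - t|) + matrixOpNorm (offDiagonal M) := by
  have e : M - t • (1 : Matrix (Fin n) (Fin n) ℝ)
      = diagonal (fun i => M i i - t) + offDiagonal M := by
    ext i j
    by_cases hij : i = j
    · subst hij
      simp [offDiagonal]
    · simp [offDiagonal, hij]
  rw [e]
  refine (matrixOpNorm_add_le _ _).trans (add_le_add ?_ le_rfl)
  exact matrixOpNorm_diagonal_le (Real.iSup_nonneg fun i => abs_nonneg _)
    fun i => le_ciSup (f := fun i => |M i i - t|) (Set.finite_range _).bddAbove i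

theorem measurable_featureKernelMatrix {U : Type*} [MeasurableSpace U] {n : ℕ} {φ : ℕ → U → ℝ}
    (hφ : ∀ j, Measurable (φ j)) (k : ℕ) (i j : Fin n) :
    Measurable fun x : Fin n → U => featureKernelMatrix φ k x i j := by
  simp only [featureKernelMatrix, of_apply]
  exact Measurable.tsum fun l => ((hφ _).comp (measurable_pi_apply i)).mul
    ((hφ _).comp (measurable_pi_apply j))

theorem offDiagonal_featureKernelMatrix {U : Type*} {n : ℕ} {φ : ℕ → U → ℝ} {x : Fin n → U}
    (hx : ∀ i, Summable fun j => φ j (x i) ^ 2) (d : ℕ) :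
    offDiagonal (featureKernelMatrix φ 0 x) =
      offDiagonal (gramMatrix (featureBlock φ 0 d) x)
        + offDiagonal (featureKernelMatrix φ d x) := by
  ext i j
  by_cases hij : i = j
  · simp [offDiagonal, hij]
  · simp only [offDiagonal, of_apply, if_neg hij, Matrix.add_apply, gramMatrix_featureBlock_apply,
      featureKernelMatrix, zero_add]
    have := (summable_mul_of_sq (hx i) (hx j)).sum_add_tsum_nat_add d
    rw [← this]
    simp only [add_comm]

namespace IsOrthogonalFeature

variable {U : Type*} [MeasurableSpace U] {P : Measure U} [IsProbabilityMeasure P]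
  {φ : ℕ → U → ℝ} {lam : ℕ → ℝ}

/-- The off-diagonal part of the leading block: either the moment order is of the order of the
hypercontractivity constant, or the block has so few dimensions that its Frobenius norm does. -/
theorem lintegral_offDiagonal_block_le (h : IsOrthogonalFeature P φ lam) {n s d : ℕ}
    (hn1 : 1 ≤ n) (hs : 1 ≤ s) (hn : n ≤ 3 ^ (s + 1)) {A α τ : ℝ} (hA : 1 ≤ A) (hα : 0 ≤ α)
    (hτ0 : 0 < τ) (hτ : τ ^ 2 = n * lam 0 * ∑' j, lam j) (hL : 0 < lam 0)
    (hnL : n * lam 0 ≤ ∑' j, lam j) (hpos : ∀ l < d, 0 < lam l)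
    (hHC : ∀ a : Fin d → ℝ, ∫⁻ u, ENNReal.ofReal ((a ⬝ᵥ featureBlock φ 0 d u) ^ (2 * s)) ∂P ≤
      ENNReal.ofReal ((A * ∑ l, a l ^ 2 * lam l) ^ s))
    (hdiag : ∫⁻ x, ENNReal.ofReal (⨆ i : Fin n, |∑' j, φ j (x i) ^ 2 - ∑' j, lam j|)
      ∂Measure.pi (fun _ : Fin n => P) ≤ ENNReal.ofReal (α * τ)) :
    ∫⁻ x, ENNReal.ofReal (matrixOpNorm (offDiagonal (gramMatrix (featureBlock φ 0 d) x)))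
      ∂Measure.pi (fun _ : Fin n => P) ≤ ENNReal.ofReal (400 * (α + A) * τ) := by
  have hn1' : (1 : ℝ) ≤ n := by exact_mod_cast hn1
  have ht : 0 < ∑' j, lam j := lt_of_lt_of_le (by positivity) hnL
  have h2 : ∀ a : Fin d → ℝ, ∫⁻ u, ENNReal.ofReal ((a ⬝ᵥ featureBlock φ 0 d u) ^ 2) ∂P ≤
      ENNReal.ofReal (∑ l, a l ^ 2 * lam l) := fun a => by
    simpa using (h.lintegral_dotProduct_sq 0 a).le
  rcases h.order_le_or_dimension_le hs (by linarith) hpos hHC with hsA | hdA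
  · refine lintegral_offDiagonal_le hn1 hs hn (h.measurable_featureBlock 0 d)
      (lam := fun l : Fin d => lam l) (fun l => h.nonneg l)
      (fun l => h.antitone (Nat.zero_le _)) hL hA ht (by
        rw [← sum_range]
        exact h.summable.sum_le_tsum _ fun j _ => h.nonneg j) hα hτ0 hτ hnL hsA h2 hHC ?_
    calc ∫⁻ x, ENNReal.ofReal (⨆ i : Fin n, ∑ l, featureBlock φ 0 d (x i) l ^ 2)
          ∂Measure.pi (fun _ : Fin n => P)
        ≤ ∫⁻ x, (ENNReal.ofReal (∑' j, lam j)
            + ENNReal.ofReal (⨆ i : Fin n, |∑' j, φ j (x i) ^ 2 - ∑' j, lam j|))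
            ∂Measure.pi (fun _ : Fin n => P) := by
          refine lintegral_mono_ae ?_
          filter_upwards [h.ae_summable_pi (n := n)] with x hx
          have h0 : 0 ≤ ⨆ i : Fin n, |∑' j, φ j (x i) ^ 2 - ∑' j, lam j| :=
            Real.iSup_nonneg fun i => abs_nonneg _
          rw [← ENNReal.ofReal_add ht.le h0]
          refine ENNReal.ofReal_le_ofReal (Real.iSup_le (fun i => ?_) (add_nonneg ht.le h0))
          have e1 : ∑ l, featureBlock φ 0 d (x i) l ^ 2 ≤ ∑' j, φ j (x i) ^ 2 := by
            simp only [featureBlock, zero_add]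
            rw [← sum_range (fun l => φ l (x i) ^ 2)]
            exact (hx i).sum_le_tsum _ fun j _ => sq_nonneg _
          have e2 := le_ciSup (f := fun i : Fin n => |∑' j, φ j (x i) ^ 2 - ∑' j, lam j|)
            (Set.finite_range _).bddAbove i
          have e3 := le_abs_self (∑' j, φ j (x i) ^ 2 - ∑' j, lam j)
          linarith
      _ ≤ _ := by
          rw [lintegral_add_left measurable_const, lintegral_const, measure_univ, mul_one,
            ENNReal.ofReal_add ht.le (by positivity)]
          exact add_le_add le_rfl hdiag
  · have hq : (n : ℝ) ^ 2 * ∑ l : Fin d, lam l ^ 2 ≤ 4 * A * τ ^ 2 := by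
      have e1 : ∑ l : Fin d, lam l ^ 2 ≤ d * lam 0 ^ 2 := by
        calc ∑ l : Fin d, lam l ^ 2 ≤ ∑ _l : Fin d, lam 0 ^ 2 := sum_le_sum fun l _ =>
              pow_le_pow_left₀ (h.nonneg _) (h.antitone (Nat.zero_le _)) 2
          _ = _ := by simp
      have e2 : n * lam 0 * (n * lam 0) ≤ τ ^ 2 := by
        rw [hτ]
        exact mul_le_mul_of_nonneg_left hnL (by positivity)
      calc (n : ℝ) ^ 2 * ∑ l : Fin d, lam l ^ 2 ≤ n ^ 2 * (d * lam 0 ^ 2) :=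
            mul_le_mul_of_nonneg_left e1 (by positivity)
        _ = d * (n * lam 0 * (n * lam 0)) := by ring
        _ ≤ d * τ ^ 2 := mul_le_mul_of_nonneg_left e2 (by positivity)
        _ ≤ _ := mul_le_mul_of_nonneg_right hdA (by positivity)
    have hk : 0 < 4 * A * τ := by positivity
    refine (lintegral_ofReal_le_of_sq hk ((lintegral_matrixOpNorm_offDiagonal_sq_le
      (h.measurable_featureBlock 0 d) (fun l : Fin d => h.nonneg l) h2).trans
      (ENNReal.ofReal_le_ofReal hq)) (by positivity)).trans (ENNReal.ofReal_le_ofReal ?_)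
    have e : 4 * A * τ / 2 + 4 * A * τ ^ 2 / (2 * (4 * A * τ)) = 2 * A * τ + τ / 2 := by
      field_simp
      ring
    rw [e]
    nlinarith [mul_nonneg hα hτ0.le, mul_le_mul_of_nonneg_right hA hτ0.le]

theorem lintegral_matrixOpNorm_sub_le (h : IsOrthogonalFeature P φ lam) {n s d : ℕ}
    (hn1 : 1 ≤ n) (hs : 1 ≤ s) (hn : n ≤ 3 ^ (s + 1)) {A α τ : ℝ} (hA : 1 ≤ A) (hα : 0 ≤ α)
    (hτ0 : 0 < τ) (hτ : τ ^ 2 = n * lam 0 * ∑' j, lam j) (hL : 0 < lam 0)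
    (hnL : n * lam 0 ≤ ∑' j, lam j) (hpos : ∀ l < d, 0 < lam l) (hd : n * lam d ≤ lam 0)
    (hHC : ∀ a : Fin d → ℝ, ∫⁻ u, ENNReal.ofReal ((a ⬝ᵥ featureBlock φ 0 d u) ^ (2 * s)) ∂P ≤
      ENNReal.ofReal ((A * ∑ l, a l ^ 2 * lam l) ^ s))
    (hdiag : ∫⁻ x, ENNReal.ofReal (⨆ i : Fin n, |∑' j, φ j (x i) ^ 2 - ∑' j, lam j|)
      ∂Measure.pi (fun _ : Fin n => P) ≤ ENNReal.ofReal (α * τ)) :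
    ∫⁻ x, ENNReal.ofReal (matrixOpNorm (featureKernelMatrix φ 0 x
        - (∑' j, lam j) • (1 : Matrix (Fin n) (Fin n) ℝ))) ∂Measure.pi (fun _ : Fin n => P)
      ≤ ENNReal.ofReal (402 * (α + A) * τ) := by
  have ht : 0 < ∑' j, lam j :=
    lt_of_lt_of_le (mul_pos (by exact_mod_cast hn1) hL) hnL
  have hblock := h.lintegral_offDiagonal_block_le hn1 hs hn hA hα hτ0 hτ hL hnL hpos hHC hdiag
  have htail : ∫⁻ x, ENNReal.ofReal (matrixOpNorm (offDiagonal (featureKernelMatrix φ d x)))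
      ∂Measure.pi (fun _ : Fin n => P) ≤ ENNReal.ofReal τ := by
    have hq : (n : ℝ) ^ 2 * (lam d * ∑' j, lam j) ≤ τ ^ 2 := by
      rw [hτ]
      nlinarith [mul_le_mul_of_nonneg_left hd (show (0 : ℝ) ≤ n * ∑' j, lam j by positivity)]
    refine (lintegral_ofReal_le_of_sq hτ0 ((h.lintegral_offDiagonal_tail_sq_le n d).trans
      (ENNReal.ofReal_le_ofReal hq)) (by positivity)).trans (ENNReal.ofReal_le_ofReal ?_)
    refine le_of_eq ?_
    field_simp
    ring
  have hm1 : Measurable fun x : Fin n → U => ENNReal.ofReal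
      (matrixOpNorm (offDiagonal (gramMatrix (featureBlock φ 0 d) x))) :=
    (measurable_matrixOpNorm_offDiagonal (h.measurable_featureBlock 0 d)).ennreal_ofReal
  have hm2 : Measurable fun x : Fin n → U => ENNReal.ofReal
      (matrixOpNorm (offDiagonal (featureKernelMatrix φ d x))) := by
    refine (measurable_matrixOpNorm fun i j => ?_).ennreal_ofReal
    by_cases hij : i = j
    · simp only [offDiagonal, of_apply, if_pos hij, measurable_const]
    · simpa only [offDiagonal, of_apply, if_neg hij] using
        measurable_featureKernelMatrix h.measurable d i j
  calc _ ≤ ∫⁻ x, (ENNReal.ofReal (⨆ i : Fin n, |∑' j, φ j (x i) ^ 2 - ∑' j, lam j|)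
          + ENNReal.ofReal (matrixOpNorm (offDiagonal (gramMatrix (featureBlock φ 0 d) x)))
          + ENNReal.ofReal (matrixOpNorm (offDiagonal (featureKernelMatrix φ d x))))
          ∂Measure.pi (fun _ : Fin n => P) := by
        refine lintegral_mono_ae ?_
        filter_upwards [h.ae_summable_pi (n := n)] with x hx
        have h0 : 0 ≤ ⨆ i : Fin n, |∑' j, φ j (x i) ^ 2 - ∑' j, lam j| :=
          Real.iSup_nonneg fun i => abs_nonneg _
        rw [← ENNReal.ofReal_add h0 (matrixOpNorm_nonneg _),
          ← ENNReal.ofReal_add (add_nonneg h0 (matrixOpNorm_nonneg _)) (matrixOpNorm_nonneg _)]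
        refine ENNReal.ofReal_le_ofReal ((matrixOpNorm_sub_smul_one_le _ _).trans ?_)
        rw [offDiagonal_featureKernelMatrix hx d, add_assoc]
        refine add_le_add (le_of_eq ?_) (matrixOpNorm_add_le _ _)
        simp [featureKernelMatrix, pow_two]
    _ ≤ ENNReal.ofReal (α * τ) + ENNReal.ofReal (400 * (α + A) * τ) + ENNReal.ofReal τ := by
        rw [lintegral_add_right _ hm2, lintegral_add_right _ hm1]
        gcongr
    _ ≤ _ := by
        rw [← ENNReal.ofReal_add (by positivity) (by positivity),
          ← ENNReal.ofReal_add (by positivity) (by positivity)]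
        refine ENNReal.ofReal_le_ofReal ?_
        nlinarith [mul_nonneg hα hτ0.le, mul_le_mul_of_nonneg_right hA hτ0.le]

end IsOrthogonalFeature

/-! ### Spectral decompositions and hypercontractivity -/

/-- The rescaled eigenfunctions `√ξ_{m+j} ψ_{m+j}`. -/
noncomputable def scaledEigenfunction {U : Type*} (ξ : ℕ → ℝ) (ψ : ℕ → U → ℝ) (m j : ℕ) (u : U) :
    ℝ :=
  √(ξ (m + j)) * ψ (m + j) u

theorem IsSpectralDecomposition.nonneg {U : Type*} [MeasurableSpace U] {P : Measure U}
    {K : U → U → ℝ} {r : ℕ∞} {ξ : ℕ → ℝ} {ψ : ℕ → U → ℝ}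
    (h : IsSpectralDecomposition P K r ξ ψ) (j : ℕ) : 0 ≤ ξ j := by
  rcases lt_or_ge (j : ℕ∞) r with hj | hj
  · exact (h.pos j hj).le
  · exact (h.zero j hj).ge

theorem IsSpectralDecomposition.isOrthogonalFeature {U : Type*} [MeasurableSpace U]
    {P : Measure U} {K : U → U → ℝ} {r : ℕ∞} {ξ : ℕ → ℝ} {ψ : ℕ → U → ℝ}
    (h : IsSpectralDecomposition P K r ξ ψ) (m : ℕ) (hsum : Summable fun j => ξ (m + j)) :
    IsOrthogonalFeature P (scaledEigenfunction ξ ψ m) (fun j => ξ (m + j)) := by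
  have hzero : ∀ j, r ≤ ((m + j : ℕ) : ℕ∞) → scaledEigenfunction ξ ψ m j = fun _ => 0 := by
    intro j hj
    funext u
    simp [scaledEigenfunction, h.zero _ hj]
  refine ⟨fun j => ?_, fun j => ?_, fun i j => ?_, fun a b hab => h.antitone (by omega), hsum⟩
  · rcases lt_or_ge ((m + j : ℕ) : ℕ∞) r with hj | hj
    · exact (h.measurable _ hj).const_mul _
    · rw [hzero j hj]
      exact measurable_const
  · rcases lt_or_ge ((m + j : ℕ) : ℕ∞) r with hj | hj
    · exact (h.memLp _ hj).const_mul _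
    · rw [hzero j hj]
      exact MemLp.zero
  · rcases lt_or_ge ((m + i : ℕ) : ℕ∞) r with hi | hi
    · rcases lt_or_ge ((m + j : ℕ) : ℕ∞) r with hj | hj
      · have e : ∀ u, scaledEigenfunction ξ ψ m i u * scaledEigenfunction ξ ψ m j u
            = (√(ξ (m + i)) * √(ξ (m + j))) * (ψ (m + i) u * ψ (m + j) u) := fun u => by
          simp only [scaledEigenfunction]; ring
        simp only [e]
        rw [integral_const_mul, h.orthonormal _ _ hi hj]
        by_cases hij : i = j
        · subst hij
          simp [Real.mul_self_sqrt (h.nonneg _)]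
        · simp [hij]
      · have : i ≠ j := by rintro rfl; exact absurd hj (not_le.2 hi)
        simp [hzero j hj, this]
    · have : ξ (m + i) = 0 := h.zero _ hi
      simp [hzero i hi, this]

theorem highKernel_eq_tsum_scaledEigenfunction {U : Type*} [MeasurableSpace U] {P : Measure U}
    {K : U → U → ℝ} {r : ℕ∞} {ξ : ℕ → ℝ} {ψ : ℕ → U → ℝ}
    (h : IsSpectralDecomposition P K r ξ ψ) (m : ℕ) (x y : U) :
    highKernel ξ ψ m x y =
      ∑' j, scaledEigenfunction ξ ψ m j x * scaledEigenfunction ξ ψ m j y := by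
  refine tsum_congr fun j => ?_
  have := Real.mul_self_sqrt (h.nonneg (m + j))
  simp only [scaledEigenfunction]
  linear_combination (-ψ (m + j) x * ψ (m + j) y) * this

theorem eLpNorm_natCast_pow {U : Type*} [MeasurableSpace U] {P : Measure U} (f : U → ℝ) {k : ℕ}
    (hk : k ≠ 0) : eLpNorm f (k : ENNReal) P ^ k = ∫⁻ u, ‖f u‖ₑ ^ k ∂P := by
  have := eLpNorm_nnreal_pow_eq_lintegral (μ := P) (f := f) (p := (k : NNReal))
    (by exact_mod_cast hk)
  simpa using this

theorem eLpNorm_natCast_pow_even {U : Type*} [MeasurableSpace U] {P : Measure U} (f : U → ℝ)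
    {s : ℕ} (hs : s ≠ 0) : (eLpNorm f ((2 * s : ℕ) : ENNReal) P ^ 2) ^ s =
      ∫⁻ u, ENNReal.ofReal (f u ^ (2 * s)) ∂P := by
  rw [← pow_mul, eLpNorm_natCast_pow f (by omega : 2 * s ≠ 0)]
  refine lintegral_congr fun u => ?_
  rw [Real.enorm_eq_ofReal_abs, ← ENNReal.ofReal_pow (abs_nonneg _), Even.pow_abs ⟨s, by ring⟩]

theorem HypercontractiveSpan.lintegral_pow_le {U : Type*} [MeasurableSpace U] {P : Measure U}
    {K : U → U → ℝ} {r : ℕ∞} {ξ : ℕ → ℝ} {ψ : ℕ → U → ℝ} {m e : ℕ} {Cbar β : ℝ}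
    (hyp : HypercontractiveSpan P ψ m e Cbar β) (h : IsSpectralDecomposition P K r ξ ψ)
    (hsum : Summable fun j => ξ (m + j)) {s : ℕ} (hs : 1 ≤ s) {A : ℝ} (hA0 : 0 ≤ A)
    (hA : (Cbar * (2 * s : ℕ)) ^ β ≤ A) (a : Fin (e - m) → ℝ) :
    ∫⁻ u, ENNReal.ofReal
        ((a ⬝ᵥ featureBlock (scaledEigenfunction ξ ψ m) 0 (e - m) u) ^ (2 * s)) ∂P ≤
      ENNReal.ofReal ((A * ∑ l, a l ^ 2 * ξ (m + l)) ^ s) := by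
  set f : U → ℝ := fun u => a ⬝ᵥ featureBlock (scaledEigenfunction ξ ψ m) 0 (e - m) u with hf
  have hspan : f ∈ Submodule.span ℝ (ψ '' Set.Ico m e) := by
    have : f = ∑ l : Fin (e - m), (a l * √(ξ (m + l))) • ψ (m + l) := by
      funext u
      simp only [hf, dotProduct, featureBlock, scaledEigenfunction, zero_add, Finset.sum_apply,
        Pi.smul_apply, smul_eq_mul, mul_assoc]
    rw [this]
    refine Submodule.sum_mem _ fun l _ => Submodule.smul_mem _ _ (Submodule.subset_span ?_)
    exact ⟨m + l, ⟨by omega, by have := l.2; omega⟩, rfl⟩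
  have h1 := hyp f hspan (2 * s) (by omega)
  have h2 : eLpNorm f 2 P ^ 2 = ENNReal.ofReal (∑ l, a l ^ 2 * ξ (m + l)) := by
    have e1 := eLpNorm_natCast_pow_even (P := P) f one_ne_zero
    have e2 := (h.isOrthogonalFeature m hsum).lintegral_dotProduct_sq 0 a
    simp only [mul_one, pow_one, Nat.cast_ofNat] at e1
    rw [e1]
    simpa using e2
  have hS : 0 ≤ ∑ l : Fin (e - m), a l ^ 2 * ξ (m + l) :=
    sum_nonneg fun l _ => mul_nonneg (sq_nonneg _) (h.nonneg _)
  rw [← eLpNorm_natCast_pow_even f (by omega : s ≠ 0),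
    ENNReal.ofReal_pow (mul_nonneg hA0 hS), ENNReal.ofReal_mul hA0, ← h2]
  refine pow_le_pow_left₀ zero_le (h1.trans ?_) s
  exact mul_le_mul_left (ENNReal.ofReal_le_ofReal hA) _

theorem HypercontractiveSpan.one_le {U : Type*} [MeasurableSpace U] {P : Measure U}
    {K : U → U → ℝ} {r : ℕ∞} {ξ : ℕ → ℝ} {ψ : ℕ → U → ℝ} {m e : ℕ} {Cbar β : ℝ}
    (hyp : HypercontractiveSpan P ψ m e Cbar β) (h : IsSpectralDecomposition P K r ξ ψ)
    (hm : m < e) (hmr : (m : ℕ∞) < r) : 1 ≤ (2 * Cbar) ^ β := by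
  have h1 := hyp (ψ m) (Submodule.subset_span ⟨m, ⟨le_rfl, hm⟩, rfl⟩) 2 le_rfl
  have h2 : eLpNorm (ψ m) 2 P ^ 2 = 1 := by
    have e1 := eLpNorm_natCast_pow_even (P := P) (ψ m) one_ne_zero
    simp only [mul_one, pow_one, Nat.cast_ofNat] at e1
    have e3 := h.orthonormal m m hmr hmr
    rw [if_pos rfl] at e3
    rw [e1]
    simp only [pow_two]
    have e4 : Integrable (fun u => ψ m u * ψ m u) P :=
      (h.memLp m hmr).integrable_mul (h.memLp m hmr)
    rw [← ofReal_integral_eq_lintegral_ofReal e4 (ae_of_all _ fun u => mul_self_nonneg _), e3,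
      ENNReal.ofReal_one]
  simp only [Nat.cast_ofNat] at h1
  rw [h2, mul_one, ENNReal.one_le_ofReal, mul_comm] at h1
  exact h1

theorem proposition1 :
    ∃ C : ℝ, 0 < C ∧
      ∀ (U : Type u) [TopologicalSpace U] [PolishSpace U] [MeasurableSpace U] [BorelSpace U]
        (P : Measure U) [IsProbabilityMeasure P]
        (K : U → U → ℝ) (_ : IsPSDKernel K) (_ : Measurable (Function.uncurry K))
        (_ : Integrable (fun x => K x x) P)
        (r : ℕ∞) (ξ : ℕ → ℝ) (ψ : ℕ → U → ℝ) (_ : IsSpectralDecomposition P K r ξ ψ)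
        (Ω : Type v) [MeasurableSpace Ω] (μ : Measure Ω) [IsProbabilityMeasure μ]
        (n : ℕ) (_ : 1 ≤ n) (_ : n ≠ 2)
        (X : Fin n → Ω → U) (_ : ∀ i, Measurable (X i)) (_ : iIndepFun X μ)
        (_ : ∀ i, μ.map (X i) = P)
        (m : ℕ) (_ : n * ξ m ≤ highTrace ξ m)
        (e : ℕ) (_ : m < e) (_ : (e : ℕ∞) ≤ r) (_ : n * ξ e ≤ ξ m)
        (Cbar βbar : ℝ) (_ : 0 < Cbar) (_ : 0 < βbar)
        (_ : HypercontractiveSpan P ψ m e Cbar βbar)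
        (α₁ : ℝ) (_ : 0 < α₁) (_ : DiagonalConcentration P μ ξ ψ m X α₁),
        Integrable (fun ω => matrixOpNorm
          (highMatrix ξ ψ m (fun i => X i ω) - highTrace ξ m • (1 : Matrix (Fin n) (Fin n) ℝ))) μ ∧
        ∫ ω, matrixOpNorm
          (highMatrix ξ ψ m (fun i => X i ω) - highTrace ξ m • (1 : Matrix (Fin n) (Fin n) ℝ)) ∂μ
          ≤ C * (α₁ + (2 * Cbar) ^ βbar * Real.log n ^ βbar)
              * √(n * ξ m / highTrace ξ m) * highTrace ξ m := by
  refine ⟨402, by norm_num, ?_⟩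
  intro U _ _ _ _ P _ K _ _ _ r ξ ψ hspec Ω _ μ _ n hn1 hn2 X hX hindep hlaw m hnξ e hme her hξe
    Cbar β hCbar hβ hhyp α hα hdc
  have hmr : (m : ℕ∞) < r := lt_of_lt_of_le (by exact_mod_cast hme) her
  have hξm : 0 < ξ m := hspec.pos m hmr
  have hn0 : (0 : ℝ) < n := by exact_mod_cast hn1
  set t := highTrace ξ m with ht
  have ht0 : 0 < t := lt_of_lt_of_le (by positivity) hnξ
  -- The trace is positive, whereas a divergent series would have the value `0`.  (For the kernels
  -- at hand convergence is automatic, the diagonal of `K` being integrable.)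
  have hsum : Summable fun j => ξ (m + j) := by
    by_contra hcon
    exact ht0.ne' (tsum_eq_zero_of_not_summable hcon)
  set φ := scaledEigenfunction ξ ψ m with hφdef
  have hφ : IsOrthogonalFeature P φ (fun j => ξ (m + j)) := hspec.isOrthogonalFeature m hsum
  set τ := √(n * ξ m * t) with hτdef
  have hτ0 : 0 < τ := Real.sqrt_pos.2 (by positivity)
  have hτ : τ ^ 2 = n * ξ m * t := Real.sq_sqrt (by positivity)
  have hτeq : √(n * ξ m / t) * t = τ := by
    rw [hτdef, ← Real.sqrt_sq ht0.le, ← Real.sqrt_mul (by positivity), Real.sqrt_sq ht0.le]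
    congr 1
    field_simp
  have hker : ∀ x y, highKernel ξ ψ m x y = ∑' j, φ j x * φ j y :=
    highKernel_eq_tsum_scaledEigenfunction hspec m
  have hdiagK : ∀ x, highKernel ξ ψ m x x = ∑' j, φ j x ^ 2 := fun x => by
    rw [hker]
    exact tsum_congr fun j => (pow_two _).symm
  have hmat : ∀ x : Fin n → U, highMatrix ξ ψ m x = featureKernelMatrix φ 0 x := by
    intro x
    ext i j
    simp only [highMatrix, featureKernelMatrix, of_apply, hker, zero_add]
  have hpres : MeasurePreserving (fun ω i => X i ω) μ (Measure.pi fun _ : Fin n => P) := by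
    refine ⟨measurable_pi_lambda _ hX, ?_⟩
    rw [(iIndepFun_iff_map_fun_eq_pi_map fun i => (hX i).aemeasurable).1 hindep]
    simp only [hlaw]
  -- The hypothesis on the diagonal, as a statement about the product measure.
  have hdiag : ∫⁻ x, ENNReal.ofReal (⨆ i : Fin n, |∑' j, φ j (x i) ^ 2 - t|)
      ∂Measure.pi (fun _ : Fin n => P) ≤ ENNReal.ofReal (α * τ) := by
    have hm : Measurable fun x : Fin n → U => ⨆ i : Fin n, |∑' j, φ j (x i) ^ 2 - t| :=
      Measurable.iSup fun i => ((hφ.measurable_diagonal.comp (measurable_pi_apply i)).sub_const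
        t).abs
    have hint : Integrable (fun x : Fin n → U => ⨆ i : Fin n, |∑' j, φ j (x i) ^ 2 - t|)
        (Measure.pi fun _ : Fin n => P) := by
      have h1 : ∀ i : Fin n, Integrable (fun x : Fin n → U => |∑' j, φ j (x i) ^ 2 - t|)
          (Measure.pi fun _ : Fin n => P) := fun i =>
        (((measurePreserving_eval (fun _ : Fin n => P) i).integrable_comp
          hφ.integrable_diagonal.aestronglyMeasurable).2 hφ.integrable_diagonal).sub
            (integrable_const t) |>.abs
      refine (integrable_finsetSum univ fun i _ => h1 i).mono' hm.aestronglyMeasurable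
        (ae_of_all _ fun x => ?_)
      rw [Real.norm_eq_abs, abs_of_nonneg (Real.iSup_nonneg fun i => abs_nonneg _)]
      exact Real.iSup_le (fun i => single_le_sum
        (f := fun i : Fin n => |∑' j, φ j (x i) ^ 2 - t|) (fun i _ => abs_nonneg _) (mem_univ i))
        (sum_nonneg fun i _ => abs_nonneg _)
    unfold DiagonalConcentration at hdc
    simp only [hdiagK, hφ.integral_diagonal] at hdc
    change ∫ ω, (⨆ i : Fin n, |∑' j, φ j (X i ω) ^ 2 - t|) ∂μ ≤ α * √(n * ξ m / t) * t at hdc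
    rw [mul_assoc, hτeq] at hdc
    rw [← ofReal_integral_eq_lintegral_ofReal hint
      (ae_of_all _ fun x => Real.iSup_nonneg fun i => abs_nonneg _)]
    refine ENNReal.ofReal_le_ofReal (le_trans (le_of_eq ?_) hdc)
    rw [← hpres.map_eq]
    exact integral_map hpres.measurable.aemeasurable hm.aestronglyMeasurable
  set A := (2 * Cbar) ^ β * Real.log n ^ β with hA
  have hA0 : 0 ≤ A := mul_nonneg (Real.rpow_nonneg (by positivity) _)
    (Real.rpow_nonneg (Real.log_natCast_nonneg n) _)
  have hmain : ∫⁻ x, ENNReal.ofReal (matrixOpNorm (featureKernelMatrix φ 0 x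
      - t • (1 : Matrix (Fin n) (Fin n) ℝ))) ∂Measure.pi (fun _ : Fin n => P)
      ≤ ENNReal.ofReal (402 * (α + A) * τ) := by
    rcases Nat.lt_or_ge n 3 with hn3 | hn3
    · -- Here `n = 1`, and there is no off-diagonal part.
      obtain rfl : n = 1 := by omega
      refine le_trans (lintegral_mono fun x => ENNReal.ofReal_le_ofReal ?_) (hdiag.trans
        (ENNReal.ofReal_le_ofReal ?_))
      · refine (matrixOpNorm_sub_smul_one_le _ _).trans (le_of_eq ?_)
        have h0 : offDiagonal (featureKernelMatrix φ 0 x) = 0 := by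
          ext i j
          simp [offDiagonal, Subsingleton.elim i j]
        rw [h0]
        simp [matrixOpNorm, featureKernelMatrix, pow_two]
      · nlinarith [mul_nonneg hA0 hτ0.le, mul_nonneg hα.le hτ0.le]
    · have hlog1 : 1 ≤ Real.log n := by
        rw [Real.le_log_iff_exp_le hn0]
        have h3 : (3 : ℝ) ≤ n := by exact_mod_cast hn3
        linarith [Real.exp_one_lt_d9]
      -- The moment order `2 s` is at most `2 log n`, so that `(Cbar * 2 s) ^ β ≤ A` without a
      -- further factor, which would not be uniform in `β`.
      set s := ⌊Real.log n⌋₊ with hs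
      have hs1 : 1 ≤ s := Nat.le_floor (by exact_mod_cast hlog1)
      have hsle : (s : ℝ) ≤ Real.log n := Nat.floor_le (by linarith)
      have hns : n ≤ 3 ^ (s + 1) := by
        have h1 : Real.log n < (s : ℝ) + 1 := Nat.lt_floor_add_one _
        have h2 : (n : ℝ) ≤ 3 ^ (s + 1) := by
          calc (n : ℝ) = Real.exp (Real.log n) := (Real.exp_log hn0).symm
            _ ≤ Real.exp (((s + 1 : ℕ) : ℝ) * 1) := Real.exp_le_exp.2 (by push_cast; linarith)
            _ = Real.exp 1 ^ (s + 1) := Real.exp_nat_mul _ _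
            _ ≤ 3 ^ (s + 1) := pow_le_pow_left₀ (Real.exp_pos 1).le
                (by linarith [Real.exp_one_lt_d9]) _
        exact_mod_cast h2
      have hA1 : 1 ≤ A := one_le_mul_of_one_le_of_one_le (hhyp.one_le hspec hme hmr)
        (Real.one_le_rpow hlog1 hβ.le)
      have hAs : (Cbar * (2 * s : ℕ)) ^ β ≤ A := by
        rw [hA, ← Real.mul_rpow (by positivity) (by linarith)]
        refine Real.rpow_le_rpow (by positivity) ?_ hβ.le
        push_cast
        nlinarith
      have hme' : m + (e - m) = e := by omega
      exact hφ.lintegral_matrixOpNorm_sub_le (d := e - m) hn1 hs1 hns hA1 hα.le hτ0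
        hτ hξm hnξ
        (fun l hl => hspec.pos _ (lt_of_lt_of_le (by exact_mod_cast (by omega : m + l < e)) her))
        (by simpa only [hme', add_zero] using hξe)
        (fun a => hhyp.lintegral_pow_le hspec hsum hs1 hA0 hAs a) hdiag
  set F : (Fin n → U) → ℝ := fun x => matrixOpNorm (featureKernelMatrix φ 0 x
      - t • (1 : Matrix (Fin n) (Fin n) ℝ)) with hF
  have hFm : Measurable F := measurable_matrixOpNorm fun i j =>
    (measurable_featureKernelMatrix hφ.measurable 0 i j).sub_const _
  have hF0 : ∀ x, 0 ≤ F x := fun x => matrixOpNorm_nonneg _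
  have hFint : Integrable F (Measure.pi fun _ : Fin n => P) := by
    refine ⟨hFm.aestronglyMeasurable, ?_⟩
    rw [hasFiniteIntegral_iff_ofReal (ae_of_all _ hF0)]
    exact lt_of_le_of_lt hmain ENNReal.ofReal_lt_top
  simp only [hmat]
  refine ⟨(hpres.integrable_comp hFm.aestronglyMeasurable).2 hFint, ?_⟩
  have hbound : 0 ≤ 402 * (α + A) * τ := by positivity
  calc ∫ ω, F (fun i => X i ω) ∂μ = ∫ x, F x ∂Measure.pi (fun _ : Fin n => P) := by
        rw [← hpres.map_eq]
        exact (integral_map hpres.measurable.aemeasurable hFm.aestronglyMeasurable).symm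
    _ ≤ 402 * (α + A) * τ := by
        rw [integral_eq_lintegral_of_nonneg_ae (ae_of_all _ hF0) hFm.aestronglyMeasurable]
        exact ENNReal.toReal_le_of_le_ofReal hbound hmain
    _ = _ := by rw [mul_assoc (402 * (α + A)), hτeq]
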